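/- Let $\gamma : S^1=\mathbb{R}/\mathbb{Z} \to \mathbb{R}^2$ be a plane curve, i.e. a generic ($C^1$) immersion of the circle: $\gamma'$ vanishes nowhere, no point of the plane has three or more preimages, and at each double point (crossing) the two velocity vectors are linearly independent. A Gauss diagram with $n$ chords is a set of $2n$ points on an oriented circle (considered only up to their cyclic order), joined in pairs by chords $c_1,\dots,c_n$. It is the Gauss diagram of $\gamma$ if its $2n$ points are, in order, the preimages of the crossings of $\gamma$, two of them being joined by a chord exactly when they have the same image; it is realizable if it is the Gauss diagram of some plane curve. Two distinct chords intersect if their endpoints alternate along the circle; a chord does not intersect itself. The intersection matrix of a Gauss diagram $\mathfrak G$ is the matrix $M(\mathfrak G)=(m_{ij})_{1\le i,j\le n}$ over $\mathbb{Z}_2$ with $m_{ii}=0$ and, for $i\neq j$, $m_{ij}=1$ if $c_i$ and $c_j$ intersect and $m_{ij}=0$ otherwise. Let $m_i=(m_{i1},\dots,m_{in})$ be its rows, and $\langle m_i,m_j\rangle=\sum_{t=1}^n m_{it}m_{jt}\in\mathbb{Z}_2$. **Theorem 4.2.** Let $\mathfrak G$ be a realizable Gauss diagram with $n$ chords. Then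 the rows of $M(\mathfrak G)$ satisfy, in $\mathbb{Z}_2$: 1. $\langle m_i,m_i\rangle = 0$ for all $1\le i\le n$; 2. $\langle m_i,m_j\rangle = 0$ whenever the chords $c_i,c_j$ do not intersect; 3. $\langle m_i,m_j\rangle+\langle m_i,m_k\rangle+\langle m_j,m_k\rangle = 1$ whenever the chords $c_i,c_j,c_k$ pairwise intersect. -/

import Mathlib

/-- A plane curve: a generic immersion of the circle `ℝ / ℤ` into the plane, given as a map of
period `1` on `ℝ`, so that the points of the circle are the parameters in `[0, 1)`.
Only `C¹` regularity is required; smooth curves are a special case. -/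
structure IsPlaneCurve (γ : ℝ → EuclideanSpace ℝ (Fin 2)) : Prop where
  periodic : Function.Periodic γ 1
  contDiff : ContDiff ℝ 1 γ
  /-- The curve is an immersion. -/
  deriv_ne_zero : ∀ t, deriv γ t ≠ 0
  /-- No point of the plane is visited three times. -/
  double : ∀ s ∈ Set.Ico (0 : ℝ) 1, ∀ t ∈ Set.Ico (0 : ℝ) 1, ∀ u ∈ Set.Ico (0 : ℝ) 1,
    γ s = γ t → γ t = γ u → s = t ∨ t = u ∨ s = u
  /-- The two branches at a double point have linearly independent velocities. -/
  transversal : ∀ s ∈ Set.Ico (0 : ℝ) 1, ∀ t ∈ Set.Ico (0 : ℝ) 1, s ≠ t → γ s = γ t →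
    LinearIndependent ℝ ![deriv γ s, deriv γ t]

/-- The parameters in `[0, 1)` at which the curve passes through a crossing, that is, the
preimages on the circle of the double points. -/
def crossingTimes (γ : ℝ → EuclideanSpace ℝ (Fin 2)) : Set ℝ :=
  {s | s ∈ Set.Ico (0 : ℝ) 1 ∧ ∃ s' ∈ Set.Ico (0 : ℝ) 1, s' ≠ s ∧ γ s' = γ s}

/-- A Gauss diagram (chord diagram) with `n` chords: `2 n` points in order along an oriented
circle, each labelled by one of the `n` chords, where every label is used exactly twice (a double
occurrence word). The two points carrying the label `i` are the endpoints of the chord `i`. -/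
structure GaussDiagram (n : ℕ) where
  word : Fin (2 * n) → Fin n
  card_eq_two : ∀ i, (Finset.univ.filter fun p => word p = i).card = 2

namespace GaussDiagram

variable {n : ℕ}

/-- `G` is the Gauss diagram of `γ`: walking once along the curve, one meets the crossings at the
times `t 0 < t 1 < ⋯`, and the labels in `G.word` record which of these meetings are at the same
crossing. -/
def IsDiagramOf (G : GaussDiagram n) (γ : ℝ → EuclideanSpace ℝ (Fin 2)) : Prop :=
  ∃ t : Fin (2 * n) → ℝ, StrictMono t ∧ Set.range t = crossingTimes γ ∧
    ∀ p q, γ (t p) = γ (t q) ↔ G.word p = G.word q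

/-- A Gauss diagram is realizable if it is the Gauss diagram of a plane curve. -/
def Realizable (G : GaussDiagram n) : Prop :=
  ∃ γ : ℝ → EuclideanSpace ℝ (Fin 2), IsPlaneCurve γ ∧ G.IsDiagramOf γ

/-- The chords `i` and `j` intersect: their endpoints alternate along the circle.
(As each label occurs only twice, a chord does not intersect itself.) -/
def Crosses (G : GaussDiagram n) (i j : Fin n) : Prop :=
  ∃ p q r s : Fin (2 * n), p < q ∧ q < r ∧ r < s ∧
    ((G.word p = i ∧ G.word q = j ∧ G.word r = i ∧ G.word s = j) ∨
      (G.word p = j ∧ G.word q = i ∧ G.word r = j ∧ G.word s = i))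

instance (G : GaussDiagram n) (i j : Fin n) : Decidable (G.Crosses i j) := by
  unfold Crosses; infer_instance

/-- The intersection matrix of a Gauss diagram over the field with two elements. -/
def matrix (G : GaussDiagram n) : Matrix (Fin n) (Fin n) (ZMod 2) :=
  Matrix.of fun i j => if i = j then 0 else if G.Crosses i j then 1 else 0

end GaussDiagram

/-! Two closed plane curves whose common points are transversal crossings or points where they only
touch cross an even number of times. All three statements come from applying this to closed curves
cut out of γ at its own crossings.

For 1, the two loops at the crossing i touch there, and their remaining common points are the chords
meeting i. For 2, two non-intersecting chords bound loops with disjoint parameter intervals, which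
cross exactly at the chords meeting both. For 3, the ends of i, j, k cut the circle into six arcs;
opposite arcs join the same two crossings and so form closed curves. Two of these curves touch at
the crossing i and cross at the chords, other than i, that meet exactly one of i, j and exactly one
of i, k. Since i itself has this property too, ⟨mᵢ + mⱼ, mᵢ + mₖ⟩ = 1, and expanding with ⟨mᵢ, mᵢ⟩ =
0 gives 3.

The parity principle rests on `BranchSign`, the monodromy of a square root of (g - z) / (g - w),
that is, the parity of the difference of the winding numbers about z and w. It is multiplicative,
locally constant off the curve, -1 across a simple transversal crossing (`BranchSign.of_crosses`)
and 1 when z = w (`BranchSign.eq_one`). Carrying the point once around the second curve gives (-1) ^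
#crossings = 1 (`even_card_of_arc_pairs`). A small translation of the second curve removes the
touching points. -/

open Set Filter Topology

/-! ### The principal square root near its branch cut -/

/-- The principal square root of a complex number. -/
noncomputable def principalSqrt (q : ℂ) : ℂ := Complex.exp (Complex.log q / 2)

lemma principalSqrt_sq {q : ℂ} (hq : q ≠ 0) : principalSqrt q ^ 2 = q := by
  rw [principalSqrt, ← Complex.exp_nat_mul]
  have : ((2 : ℕ) : ℂ) * (Complex.log q / 2) = Complex.log q := by push_cast; ring
  rw [this, Complex.exp_log hq]

lemma continuousAt_principalSqrt {q : ℂ} (hq : q ∈ Complex.slitPlane) :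
    ContinuousAt principalSqrt q :=
  Complex.continuous_exp.continuousAt.comp ((continuousAt_clog hq).div_const 2)

/-- At -1, on the cut, the logarithm is still continuous from above because arguments are taken in
(-π, π]. -/
lemma continuousWithinAt_principalSqrt_neg_one :
    ContinuousWithinAt principalSqrt {z | 0 ≤ z.im} (-1) := by
  have := Complex.continuousWithinAt_log_of_re_neg_of_im_zero (z := -1) (by simp) (by simp)
  exact Complex.continuous_exp.continuousAt.comp_continuousWithinAt (this.div_const 2)

lemma principalSqrt_neg_one : principalSqrt (-1) = Complex.I := by
  have h : (Real.pi * Complex.I / 2 : ℂ) = Real.pi / 2 * Complex.I := by ring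
  rw [principalSqrt, Complex.log_neg_one, h, Complex.exp_pi_div_two_mul_I]

/-- Conjugating inside and outside turns continuity at the cut from above into continuity from
below, and changes nothing off the cut. -/
lemma principalSqrt_conj {q : ℂ} (hq : q ∈ Complex.slitPlane) :
    (starRingEnd ℂ) (principalSqrt ((starRingEnd ℂ) q)) = principalSqrt q := by
  rw [principalSqrt, principalSqrt, Complex.log_conj _ (Complex.slitPlane_arg_ne_pi hq),
    ← Complex.exp_conj, map_div₀, Complex.conj_conj, Complex.conj_ofNat]

/-! ### The monodromy sign of a closed curve relative to two points -/

/-- For a pair of arcs `g` on `[c, d]` and `g` on `[c', d']` with common endpoints, forming a closed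
curve, the quotient `(g - z) / (g - w)` has a continuous square root whose monodromy along the
closed curve is `σ`. A closed arc `[c, d]` is the special case `c' = d' = c`. -/
def BranchSign (g : ℝ → ℂ) (c d c' d' : ℝ) (z w σ : ℂ) : Prop :=
  ∃ r : ℝ → ℂ, ContinuousOn r (Icc c d ∪ Icc c' d') ∧
    (∀ t ∈ Icc c d ∪ Icc c' d', g t ≠ z ∧ g t ≠ w ∧ r t ^ 2 * (g t - w) = g t - z) ∧
    r d * r c' = σ * (r c * r d')

namespace BranchSign

variable {g : ℝ → ℂ} {c d c' d' : ℝ} {x y z w σ τ : ℂ}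

lemma trans (h₁ : BranchSign g c d c' d' x y σ) (h₂ : BranchSign g c d c' d' y z τ) :
    BranchSign g c d c' d' x z (σ * τ) := by
  obtain ⟨r, hr, hr2, hr3⟩ := h₁
  obtain ⟨q, hq, hq2, hq3⟩ := h₂
  refine ⟨fun t => r t * q t, hr.mul hq, fun t ht => ⟨(hr2 t ht).1, (hq2 t ht).2.1, ?_⟩, ?_⟩
  · have h1 := (hr2 t ht).2.2
    have h2 := (hq2 t ht).2.2
    rw [← h1, ← h2]; ring
  · linear_combination (q d * q c') * hr3 + σ * (r c * r d') * hq3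

lemma root_ne_zero {r : ℝ → ℂ} {X : Set ℝ}
    (h : ∀ t ∈ X, g t ≠ z ∧ g t ≠ w ∧ r t ^ 2 * (g t - w) = g t - z) {t : ℝ} (ht : t ∈ X) :
    r t ≠ 0 := by
  intro h0
  have := (h t ht).2.2
  rw [h0] at this
  apply (h t ht).1
  simpa [sub_eq_zero, eq_comm] using this

lemma symm (hσ : σ * σ = 1) (hc : c ≤ d) (hc' : c' ≤ d') (h : BranchSign g c d c' d' x y σ) :
    BranchSign g c d c' d' y x σ := by
  obtain ⟨r, hr, hr2, hr3⟩ := h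
  have h0 := fun t (ht : t ∈ Icc c d ∪ Icc c' d') => root_ne_zero hr2 ht
  refine ⟨fun t => (r t)⁻¹, hr.inv₀ h0,
    fun t ht => ⟨(hr2 t ht).2.1, (hr2 t ht).1, ?_⟩, ?_⟩
  · have := h0 t ht
    rw [← (hr2 t ht).2.2]; field_simp
  · have h1 := h0 c (by simp [hc])
    have h2 := h0 d (by simp [hc])
    have h3 := h0 c' (by simp [hc'])
    have h4 := h0 d' (by simp [hc'])
    simp only
    field_simp
    linear_combination (-σ) * hr3 - (r c * r d') * hσ

/-- The quotient is 1 + (w - z) / (g - w), within distance less than 1 of 1, so the principal root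
is continuous along the curve. It depends on g alone, so it agrees at the common endpoints. -/
lemma of_norm_lt (hg : ContinuousOn g (Icc c d ∪ Icc c' d')) (hcc : g c = g c') (hdd : g d = g d')
    (h : ∀ t ∈ Icc c d ∪ Icc c' d', ‖z - w‖ < ‖g t - w‖) : BranchSign g c d c' d' z w 1 := by
  have hw : ∀ t ∈ Icc c d ∪ Icc c' d', g t - w ≠ 0 := fun t ht =>
    norm_pos_iff.1 ((norm_nonneg _).trans_lt (h t ht))
  have hz : ∀ t ∈ Icc c d ∪ Icc c' d', g t ≠ z := fun t ht h0 => by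
    have := h t ht; rw [h0] at this; exact lt_irrefl _ this
  have hs : ∀ t ∈ Icc c d ∪ Icc c' d', (g t - z) / (g t - w) ∈ Complex.slitPlane := fun t ht => by
    have : (g t - z) / (g t - w) = 1 + (w - z) / (g t - w) := by
      have := hw t ht
      field_simp; ring
    rw [this]
    apply Complex.mem_slitPlane_of_norm_lt_one
    rw [norm_div, norm_sub_rev, div_lt_one (norm_pos_iff.2 (hw t ht))]
    exact h t ht
  refine ⟨fun t => principalSqrt ((g t - z) / (g t - w)), ?_, fun t ht => ⟨hz t ht,
    sub_ne_zero.1 (hw t ht), ?_⟩, ?_⟩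
  · intro t ht
    have hq : ContinuousWithinAt (fun t => (g t - z) / (g t - w)) (Icc c d ∪ Icc c' d') t :=
      ((hg t ht).sub continuousWithinAt_const).div
        ((hg t ht).sub continuousWithinAt_const) (hw t ht)
    exact (continuousAt_principalSqrt (hs t ht)).tendsto.comp hq
  · have h1 := hw t ht
    rw [principalSqrt_sq (div_ne_zero (sub_ne_zero.2 (hz t ht)) h1)]
    field_simp
  · simp only [hcc, hdd]; ring

/-- Here r² = 1, so r is constant on each arc by connectedness and the monodromy is trivial. -/
lemma eq_one (hc : c ≤ d) (hc' : c' ≤ d') (h : BranchSign g c d c' d' z z σ) : σ = 1 := by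
  obtain ⟨r, hr, hr2, hr3⟩ := h
  have h0 := fun t (ht : t ∈ Icc c d ∪ Icc c' d') => root_ne_zero hr2 ht
  have key : ∀ p q, p ≤ q → Icc p q ⊆ Icc c d ∪ Icc c' d' → r q = r p := by
    intro p q hpq hs
    have hp : p ∈ Icc p q := ⟨le_rfl, hpq⟩
    have hq : q ∈ Icc p q := ⟨hpq, le_rfl⟩
    have hsq : ∀ t ∈ Icc p q, r t ^ 2 = 1 := fun t ht => by
      have h1 := hr2 t (hs ht)
      exact mul_right_cancel₀ (sub_ne_zero.2 h1.1) (by rw [h1.2.2, one_mul])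
    have := (isPreconnected_Icc (a := p) (b := q)).eq_or_eq_neg_of_sq_eq (f := r) (g := fun _ => 1)
      (hr.mono hs) continuousOn_const (fun t ht => by simp [hsq t ht]) (fun _ => one_ne_zero)
    rcases this with h | h
    · rw [h hp, h hq]
    · rw [h hp, h hq]; rfl
  rw [key c d hc subset_union_left, key c' d' hc' subset_union_right] at hr3
  have h1 := h0 c (by simp [hc])
  have h3 := h0 c' (by simp [hc'])
  have : (r c * r c') ≠ 0 := mul_ne_zero h1 h3
  exact (mul_right_cancel₀ this (by rw [one_mul]; exact hr3)).symm

lemma affine (h : BranchSign g c d c' d' z w σ) {u : ℂ} (hu : u ≠ 0) (v : ℂ) {f : ℝ → ℂ}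
    (hf : ∀ t, f t = v + u * g t) :
    BranchSign f c d c' d' (v + u * z) (v + u * w) σ := by
  obtain ⟨r, hr, hr2, hr3⟩ := h
  refine ⟨r, hr, fun t ht => ⟨?_, ?_, ?_⟩, hr3⟩
  · rw [hf]; simpa [hu] using (hr2 t ht).1
  · rw [hf]; simpa [hu] using (hr2 t ht).2.1
  · rw [hf]; linear_combination u * (hr2 t ht).2.2

lemma locally_one (hg : ContinuousOn g (Icc c d ∪ Icc c' d')) (hcc : g c = g c') (hdd : g d = g d')
    (h : ∀ t ∈ Icc c d ∪ Icc c' d', g t ≠ w) : ∀ᶠ z in 𝓝 w, BranchSign g c d c' d' z w 1 := by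
  have hX : IsCompact (Icc c d ∪ Icc c' d') := isCompact_Icc.union isCompact_Icc
  have hcl : IsClosed (g '' (Icc c d ∪ Icc c' d')) := (hX.image_of_continuousOn hg).isClosed
  have hw : w ∈ (g '' (Icc c d ∪ Icc c' d'))ᶜ := by
    rintro ⟨t, ht, rfl⟩; exact h t ht rfl
  obtain ⟨ε, hε, hball⟩ := Metric.mem_nhds_iff.1 (hcl.isOpen_compl.mem_nhds hw)
  filter_upwards [Metric.ball_mem_nhds w hε] with z hz
  refine of_norm_lt hg hcc hdd fun t ht => ?_
  by_contra hcon
  rw [not_lt] at hcon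
  refine hball (show g t ∈ Metric.ball w ε from ?_) ⟨t, ht, rfl⟩
  rw [mem_ball_iff_norm] at hz ⊢
  exact hcon.trans_lt hz

end BranchSign

/-! ### Local geometry at a transversal crossing -/

/-- Near t₀ the slopes of y are close to v, so y stays in a cone about the line spanned by v, away
from the real axis. -/
lemma HasDerivAt.exists_cone {y : ℝ → ℂ} {v : ℂ} {t₀ : ℝ} (hy : HasDerivAt y v t₀) (h0 : y t₀ = 0)
    (hv : v.im < 0) : ∃ κ > 0, ∃ ρ > 0, ∀ t, |t - t₀| < ρ →
      κ * ‖y t‖ ≤ |(y t).im| ∧ (t < t₀ → 0 < (y t).im) ∧ (t₀ < t → (y t).im < 0) := by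
  have hn : 0 < ‖v‖ + 1 := by positivity
  -- Enlarging the denominator from ‖v‖ to ‖v‖ + 1 makes κ * ‖v‖ < -v.im strict, hence an open
  -- condition that nearby slopes inherit.
  set κ : ℝ := -v.im / (‖v‖ + 1) with hκ
  have hκ0 : 0 < κ := div_pos (neg_pos.2 hv) hn
  have hlt : κ * ‖v‖ < -v.im := by
    have : κ * (‖v‖ + 1) = -v.im := by rw [hκ]; field_simp
    nlinarith
  have hopen : IsOpen {m : ℂ | m.im < 0 ∧ κ * ‖m‖ < -m.im} :=
    (isOpen_lt Complex.continuous_im continuous_const).inter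
      (isOpen_lt (continuous_const.mul continuous_norm) Complex.continuous_im.neg)
  have hev := (hasDerivAt_iff_tendsto_slope.1 hy).eventually (hopen.mem_nhds ⟨hv, hlt⟩)
  rw [eventually_nhdsWithin_iff, Metric.eventually_nhds_iff] at hev
  obtain ⟨ρ, hρ, hev⟩ := hev
  refine ⟨κ, hκ0, ρ, hρ, fun t ht => ?_⟩
  by_cases htt : t = t₀
  · subst htt; simp [h0]
  obtain ⟨h1, h2⟩ := hev (by rwa [Real.dist_eq]) htt
  set m := slope y t₀ t with hm
  have hym : y t = ((t - t₀ : ℝ) : ℂ) * m := by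
    have := sub_smul_slope y t₀ t
    rw [vsub_eq_sub, h0, sub_zero] at this
    rw [hm, ← this, Complex.real_smul]
  have him : (y t).im = (t - t₀) * m.im := by rw [hym, Complex.im_ofReal_mul]
  refine ⟨?_, fun h => ?_, fun h => ?_⟩
  · rw [him, hym, norm_mul, Complex.norm_real, Real.norm_eq_abs, abs_mul, abs_of_neg h1]
    have := abs_nonneg (t - t₀)
    nlinarith
  · rw [him]; nlinarith
  · rw [him]; nlinarith

/-- A compact family of nonzero points is bounded away from zero. -/
lemma exists_norm_lower_bound {y : ℝ → ℂ} {X : Set ℝ} {t₀ ρ : ℝ} (hX : IsCompact X)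
    (hy : ContinuousOn y X) (hne : ∀ t ∈ X, t ≠ t₀ → y t ≠ 0) (hρ : 0 < ρ) :
    ∃ m > 0, ∀ t ∈ X, ρ ≤ |t - t₀| → m ≤ ‖y t‖ := by
  have hK : IsCompact (X ∩ {t | ρ ≤ |t - t₀|}) :=
    hX.inter_right (isClosed_le continuous_const (by fun_prop))
  obtain ⟨m, hm, h⟩ := hK.exists_forall_le' (f := fun t => ‖y t‖) (a := 0)
    (hy.mono inter_subset_left).norm (fun t ht => norm_pos_iff.2 (hne t ht.1 (by
      rintro rfl
      have := ht.2
      simp only [mem_ofPred_eq, sub_self, abs_zero] at this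
      linarith)))
  exact ⟨m, hm, fun t ht h' => h t ⟨ht, h'⟩⟩

/-- The bound is linear in ε so that it absorbs the o(ε) error between a differentiable path and its
tangent line. -/
lemma exists_linear_separation {y : ℝ → ℂ} {X : Set ℝ} {t₀ : ℝ} {v : ℂ} (hX : IsCompact X)
    (hy : ContinuousOn y X) (hne : ∀ t ∈ X, t ≠ t₀ → y t ≠ 0) (hd : HasDerivAt y v t₀)
    (h0 : y t₀ = 0) (hv : v.im < 0) :
    ∃ κ > 0, ∀ᶠ ε : ℝ in 𝓝[>] 0, ∀ t ∈ X, κ * ε ≤ ‖y t - ε‖ ∧ κ * ε ≤ ‖y t + ε‖ := by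
  obtain ⟨κ, hκ, ρ, hρ, hcone⟩ := hd.exists_cone h0 hv
  obtain ⟨m, hm, hfar⟩ := exists_norm_lower_bound hX hy hne hρ
  -- In the cone, ‖a - b‖ ≥ κ‖a‖ ≥ κ(e - ‖a - b‖), which gives κ / (1 + κ). Far away, ‖a‖ ≥ 2e gives
  -- the constant 1.
  have key : ∀ (a : ℂ) (e : ℝ), 0 < e → (κ * ‖a‖ ≤ |a.im| ∨ 2 * e ≤ ‖a‖) →
      ∀ b : ℂ, b.im = 0 → ‖b‖ = e → min 1 (κ / (1 + κ)) * e ≤ ‖a - b‖ := by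
    intro a e he h b hb hbe
    have htri : ‖a‖ ≥ e - ‖a - b‖ := by
      have := norm_sub_norm_le b a
      rw [hbe, norm_sub_rev] at this; linarith
    have htri' : ‖a‖ - e ≤ ‖a - b‖ := by
      have := norm_sub_norm_le a b
      rwa [hbe] at this
    rcases h with h | h
    · have him : |a.im| ≤ ‖a - b‖ := by
        have := Complex.abs_im_le_norm (a - b)
        simpa [hb] using this
      have : κ / (1 + κ) * e ≤ ‖a - b‖ := by
        rw [div_mul_eq_mul_div, div_le_iff₀ (by positivity)]
        nlinarith
      exact (mul_le_mul_of_nonneg_right (min_le_right _ _) he.le).trans this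
    · have : 1 * e ≤ ‖a - b‖ := by linarith
      exact (mul_le_mul_of_nonneg_right (min_le_left _ _) he.le).trans this
  refine ⟨min 1 (κ / (1 + κ)), by positivity, ?_⟩
  filter_upwards [self_mem_nhdsWithin, Ioo_mem_nhdsGT (show (0 : ℝ) < m / 2 by positivity)]
    with ε hε hε2 t ht
  have hε : 0 < ε := hε
  have hor : κ * ‖y t‖ ≤ |(y t).im| ∨ 2 * ε ≤ ‖y t‖ := by
    rcases lt_or_ge |t - t₀| ρ with h | h
    · exact Or.inl (hcone t h).1
    · exact Or.inr (by linarith [hfar t ht h, hε2.2])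
  constructor
  · exact key _ ε hε hor ε (by simp) (by simp [abs_of_pos hε])
  · have := key _ ε hε hor (-ε : ℂ) (by simp) (by simp [abs_of_pos hε])
    simpa using this

namespace BranchSign

variable {g y : ℝ → ℂ} {c d c' d' : ℝ}

/-- The quotient q = (y - ε) / (y + ε) meets the cut only at t₀, at -1, passing from above to below.
Elsewhere near t₀ its imaginary part is nonzero, and away from t₀ it is close to 1. The continuous
root is thus the principal one before t₀ and its negative after. -/
lemma of_crosses_real_axis {t₀ : ℝ} {v : ℂ} (hc' : c' ≤ d')
    (hy : ContinuousOn y (Icc c d ∪ Icc c' d')) (hcc : y c = y c') (hdd : y d = y d')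
    (ht₀ : t₀ ∈ Ioo c d) (ht₀' : t₀ ∉ Icc c' d')
    (hne : ∀ t ∈ Icc c d ∪ Icc c' d', t ≠ t₀ → y t ≠ 0) (hd : HasDerivAt y v t₀)
    (h0 : y t₀ = 0) (hv : v.im < 0) :
    ∀ᶠ ε : ℝ in 𝓝[>] 0, BranchSign y c d c' d' ε (-ε) (-1) := by
  set X := Icc c d ∪ Icc c' d' with hXdef
  have hX : IsCompact X := isCompact_Icc.union isCompact_Icc
  obtain ⟨κ, hκ, ρ, hρ, hcone⟩ := hd.exists_cone h0 hv
  obtain ⟨m, hm, hfar⟩ := exists_norm_lower_bound hX hy hne hρ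
  obtain ⟨κ', hκ', hsep⟩ := exists_linear_separation hX hy hne hd h0 hv
  filter_upwards [self_mem_nhdsWithin, hsep, Ioo_mem_nhdsGT (show (0 : ℝ) < m / 3 by positivity)]
    with ε hε hsep hε2
  have hε : 0 < ε := hε
  have hεm : ε < m / 3 := hε2.2
  have hn1 : ∀ t ∈ X, y t - ε ≠ 0 := fun t ht =>
    norm_pos_iff.1 ((mul_pos hκ' hε).trans_le (hsep t ht).1)
  have hn2 : ∀ t ∈ X, y t + ε ≠ 0 := fun t ht =>
    norm_pos_iff.1 ((mul_pos hκ' hε).trans_le (hsep t ht).2)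
  set q : ℝ → ℂ := fun t => (y t - ε) / (y t + ε) with hq
  have hqcont : ContinuousOn q X := fun t ht =>
    ((hy t ht).sub continuousWithinAt_const).div ((hy t ht).add continuousWithinAt_const) (hn2 t ht)
  have hq0 : q t₀ = -1 := by
    have : (ε : ℂ) ≠ 0 := by exact_mod_cast hε.ne'
    simp only [hq, h0]
    rw [zero_sub, zero_add, neg_div, div_self this]
  have him : ∀ t ∈ X, (q t).im = 2 * ε * (y t).im / Complex.normSq (y t + ε) := fun t ht => by
    simp only [hq, Complex.div_im]
    simp; ring
  have hpos : ∀ t ∈ X, 0 < Complex.normSq (y t + ε) := fun t ht =>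
    Complex.normSq_pos.2 (hn2 t ht)
  have him1 : ∀ t ∈ X, |t - t₀| < ρ → t < t₀ → 0 < (q t).im := fun t ht h h' => by
    rw [him t ht]
    have := (hcone t h).2.1 h'
    have := hpos t ht
    positivity
  have him2 : ∀ t ∈ X, |t - t₀| < ρ → t₀ < t → (q t).im < 0 := fun t ht h h' => by
    rw [him t ht]
    have := (hcone t h).2.2 h'
    exact div_neg_of_neg_of_pos (mul_neg_of_pos_of_neg (by positivity) this) (hpos t ht)
  have hslit : ∀ t ∈ X, t ≠ t₀ → q t ∈ Complex.slitPlane := by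
    intro t ht htt
    rcases lt_or_ge |t - t₀| ρ with h | h
    · right
      rcases lt_or_gt_of_ne htt with h' | h'
      · exact (him1 t ht h h').ne'
      · exact (him2 t ht h h').ne
    · have h1 : q t = 1 + (-(2 * ε : ℂ)) / (y t + ε) := by
        have := hn2 t ht
        simp only [hq]; field_simp; ring
      rw [h1]
      apply Complex.mem_slitPlane_of_norm_lt_one
      rw [norm_div, div_lt_one (norm_pos_iff.2 (hn2 t ht))]
      have h2 := norm_sub_le (y t + ε) ε
      have h3 : ‖(ε : ℂ)‖ = ε := by simp [abs_of_pos hε]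
      rw [add_sub_cancel_right, h3] at h2
      have h4 := hfar t ht h
      have h5 : ‖-(2 * ε : ℂ)‖ = 2 * ε := by simp [abs_of_pos hε]
      rw [h5]
      linarith
  have hqne : ∀ t ∈ X, q t ≠ 0 := fun t ht => div_ne_zero (hn1 t ht) (hn2 t ht)
  set conj := starRingEnd ℂ
  have hleft : ContinuousOn (fun t => principalSqrt (q t)) (X ∩ Iic t₀) := by
    intro t ht
    by_cases htt : t = t₀
    · have hqt : q t = -1 := by rw [htt, hq0]
      have hc1 : Tendsto q (𝓝[X ∩ Iic t₀] t) (𝓝[{z | 0 ≤ z.im}] (-1)) := by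
        refine tendsto_nhdsWithin_iff.2 ⟨?_, ?_⟩
        · have : Tendsto q _ _ := (hqcont t ht.1).mono_left (nhdsWithin_mono t (inter_subset_left (t := Iic t₀)))
          rwa [hqt] at this
        · have hb : Ioo (t₀ - ρ) (t₀ + ρ) ∈ 𝓝[X ∩ Iic t₀] t :=
            mem_nhdsWithin_of_mem_nhds (by rw [htt]; exact Ioo_mem_nhds (by linarith) (by linarith))
          filter_upwards [self_mem_nhdsWithin, hb] with s hs hs'
          rcases eq_or_lt_of_le (show s ≤ t₀ from hs.2) with h | h
          · rw [h, hq0]; simp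
          · exact (him1 s hs.1 (abs_lt.2 ⟨by linarith [hs'.1], by linarith [hs'.2]⟩) h).le
      have hc2 := continuousWithinAt_principalSqrt_neg_one.tendsto.comp hc1
      show Tendsto _ _ (𝓝 (principalSqrt (q t)))
      rw [hqt]; exact hc2
    · exact (continuousAt_principalSqrt (hslit t ht.1 htt)).tendsto.comp
        ((hqcont t ht.1).mono inter_subset_left)
  -- The conjugated form equals minus the principal root off the cut, and at -1 its value is I,
  -- which matches the left branch.
  have hright : ContinuousOn (fun t => -conj (principalSqrt (conj (q t)))) (X ∩ Ici t₀) := by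
    intro t ht
    by_cases htt : t = t₀
    · have hqt : q t = -1 := by rw [htt, hq0]
      have hc1 : Tendsto (fun t => conj (q t)) (𝓝[X ∩ Ici t₀] t) (𝓝[{z | 0 ≤ z.im}] (-1)) := by
        refine tendsto_nhdsWithin_iff.2 ⟨?_, ?_⟩
        · have : Tendsto q _ _ := (hqcont t ht.1).mono_left (nhdsWithin_mono t (inter_subset_left (t := Ici t₀)))
          rw [hqt] at this
          have := (Complex.continuous_conj.tendsto (-1)).comp this
          rwa [map_neg, map_one] at this
        · have hb : Ioo (t₀ - ρ) (t₀ + ρ) ∈ 𝓝[X ∩ Ici t₀] t :=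
            mem_nhdsWithin_of_mem_nhds (by rw [htt]; exact Ioo_mem_nhds (by linarith) (by linarith))
          filter_upwards [self_mem_nhdsWithin, hb] with s hs hs'
          simp only [conj, Complex.conj_im]
          rcases eq_or_lt_of_le (show t₀ ≤ s from hs.2) with h | h
          · rw [← h, hq0]; simp
          · linarith [(him2 s hs.1 (abs_lt.2 ⟨by linarith [hs'.1], by linarith [hs'.2]⟩) h)]
      have hc2 := continuousWithinAt_principalSqrt_neg_one.tendsto.comp hc1
      have hc3 := ((Complex.continuous_conj.tendsto _).comp hc2).neg
      show Tendsto _ _ (𝓝 (-conj (principalSqrt (conj (q t)))))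
      have : conj (q t) = -1 := by rw [hqt]; simp [conj]
      rw [this]; exact hc3
    · have hc1 : ContinuousWithinAt (fun t => -principalSqrt (q t)) (X ∩ Ici t₀) t :=
        Tendsto.neg ((continuousAt_principalSqrt (hslit t ht.1 htt)).tendsto.comp
          ((hqcont t ht.1).mono inter_subset_left))
      refine hc1.congr_of_eventuallyEq ?_ (by rw [principalSqrt_conj (hslit t ht.1 htt)])
      filter_upwards [self_mem_nhdsWithin,
        mem_nhdsWithin_of_mem_nhds (isOpen_ne.mem_nhds htt)] with s hs hs'
      rw [principalSqrt_conj (hslit s hs.1 hs')]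
  set r : ℝ → ℂ := fun t => if t ≤ t₀ then principalSqrt (q t)
    else -conj (principalSqrt (conj (q t))) with hr
  have hrlt : ∀ t ∈ X, t < t₀ → r t = principalSqrt (q t) := fun t _ h => if_pos h.le
  have hrgt : ∀ t ∈ X, t₀ < t → r t = -principalSqrt (q t) := fun t ht h => by
    rw [hr]; simp only [not_le.2 h, if_false]
    rw [principalSqrt_conj (hslit t ht h.ne')]
  have hc0 : c ∈ X := Or.inl ⟨le_rfl, (ht₀.1.trans ht₀.2).le⟩
  have hd0 : d ∈ X := Or.inl ⟨(ht₀.1.trans ht₀.2).le, le_rfl⟩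
  have hc0' : c' ∈ X := Or.inr ⟨le_rfl, hc'⟩
  have hd0' : d' ∈ X := Or.inr ⟨hc', le_rfl⟩
  have hqc : q c = q c' := by simp only [hq, hcc]
  have hqd : q d = q d' := by simp only [hq, hdd]
  refine ⟨r, ?_, fun t ht => ⟨sub_ne_zero.1 (hn1 t ht), ?_, ?_⟩, ?_⟩
  · refine ContinuousOn.if ?_ ?_ ?_
    · rintro a ⟨_, ha⟩
      rw [show {a | a ≤ t₀} = Iic t₀ from rfl, frontier_Iic] at ha
      rw [mem_singleton_iff.1 ha, hq0]
      simp [conj, principalSqrt_neg_one]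
    · rw [show {a | a ≤ t₀} = Iic t₀ from rfl, closure_Iic]; exact hleft
    · rw [show {a | ¬ a ≤ t₀} = Ioi t₀ by ext; simp, closure_Ioi]; exact hright
  · intro h; apply hn2 t ht; rw [h]; ring
  · have h1 : r t ^ 2 = q t := by
      by_cases htt : t = t₀
      · rw [htt, hr]; simp only [le_refl, if_true]
        rw [principalSqrt_sq (hqne t₀ (htt ▸ ht))]
      · rcases lt_or_gt_of_ne htt with h | h
        · rw [hrlt t ht h, principalSqrt_sq (hqne t ht)]
        · rw [hrgt t ht h, neg_sq, principalSqrt_sq (hqne t ht)]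
    rw [h1]
    have := hn2 t ht
    simp only [hq]; field_simp; ring
  -- The first arc picks up one sign change. The second lies wholly on one side of t₀, so both its
  -- ends carry the same sign.
  · rw [hrlt c hc0 ht₀.1, hrgt d hd0 ht₀.2]
    by_cases h : t₀ < c'
    · rw [hrgt c' hc0' h, hrgt d' hd0' (h.trans_le hc'), hqc, hqd]; ring
    · have h' : d' < t₀ := by
        by_contra h'; exact ht₀' ⟨not_lt.1 h, not_lt.1 h'⟩
      rw [hrlt c' hc0' (hc'.trans_lt h'), hrlt d' hd0' h', hqc, hqd]; ring

lemma swap {z w σ : ℂ} (hσ : σ * σ = 1) (h : BranchSign g c d c' d' z w σ) :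
    BranchSign g c' d' c d z w σ := by
  obtain ⟨r, hr, hr2, hr3⟩ := h
  rw [union_comm] at hr hr2
  refine ⟨r, hr, hr2, ?_⟩
  linear_combination (-σ) * hr3 - (r c * r d') * hσ

end BranchSign

/-! ### Sign changes along a moving point -/

namespace BranchSign

variable {g α : ℝ → ℂ} {a b c d c' d' : ℝ}

/-- An affine change of coordinates gives α unit real velocity, so α (s₀ ± ε) becomes ±ε + o(ε).
Linear separation allows replacing it by ±ε at no cost in sign. -/
lemma of_crosses_of_im_neg {s₀ t₀ : ℝ} {u v : ℂ} (hc' : c' ≤ d')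
    (hg : ContinuousOn g (Icc c d ∪ Icc c' d')) (hcc : g c = g c') (hdd : g d = g d')
    (ht₀ : t₀ ∈ Ioo c d) (ht₀' : t₀ ∉ Icc c' d')
    (hne : ∀ t ∈ Icc c d ∪ Icc c' d', t ≠ t₀ → g t ≠ g t₀) (hα : HasDerivAt α u s₀)
    (hd : HasDerivAt g v t₀) (h0 : α s₀ = g t₀) (hv : (v / u).im < 0) :
    ∀ᶠ ε : ℝ in 𝓝[>] 0, BranchSign g c d c' d' (α (s₀ + ε)) (α (s₀ - ε)) (-1) := by
  have hu : u ≠ 0 := by rintro rfl; simp at hv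
  set y : ℝ → ℂ := fun t => (g t - g t₀) / u with hydef
  set A : ℝ → ℂ := fun s => (α s - g t₀) / u with hAdef
  have hX : IsCompact (Icc c d ∪ Icc c' d') := isCompact_Icc.union isCompact_Icc
  have hy : ContinuousOn y (Icc c d ∪ Icc c' d') := (hg.sub continuousOn_const).div_const u
  have hycc : y c = y c' := by simp only [hydef, hcc]
  have hydd : y d = y d' := by simp only [hydef, hdd]
  have hyne : ∀ t ∈ Icc c d ∪ Icc c' d', t ≠ t₀ → y t ≠ 0 := fun t ht h =>
    div_ne_zero (sub_ne_zero.2 (hne t ht h)) hu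
  have hyd : HasDerivAt y (v / u) t₀ := (hd.sub_const _).div_const u
  have hy0 : y t₀ = 0 := by simp [hydef]
  have hA : HasDerivAt A 1 s₀ := by
    have := (hα.sub_const (g t₀)).div_const u
    rwa [div_self hu] at this
  have hA0 : A s₀ = 0 := by simp [hAdef, h0]
  obtain ⟨κ, hκ, hsep⟩ := exists_linear_separation hX hy hyne hyd hy0 hv
  have hlin := (hasDerivAt_iff_isLittleO.1 hA).def (half_pos hκ)
  obtain ⟨η, hη, hlin⟩ := Metric.eventually_nhds_iff.1 hlin
  filter_upwards [of_crosses_real_axis hc' hy hycc hydd ht₀ ht₀' hyne hyd hy0 hv, hsep,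
    Ioo_mem_nhdsGT hη] with ε h1 hsep hε
  have hp : ‖A (s₀ + ε) - ε‖ < κ * ε := by
    have := hlin (y := s₀ + ε) (by simpa [abs_of_pos hε.1] using hε.2)
    simp only [hA0, sub_zero, add_sub_cancel_left, Complex.real_smul, mul_one, Real.norm_eq_abs,
      abs_of_pos hε.1] at this
    have := mul_pos hκ hε.1
    linarith
  have hm : ‖A (s₀ - ε) - -ε‖ < κ * ε := by
    have := hlin (y := s₀ - ε) (by simpa [abs_of_pos hε.1] using hε.2)
    rw [show s₀ - ε - s₀ = -ε by ring] at this
    simp only [hA0, sub_zero, Complex.real_smul, mul_one, Real.norm_eq_abs, abs_neg,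
      abs_of_pos hε.1, Complex.ofReal_neg] at this
    have := mul_pos hκ hε.1
    linarith
  have hcd : c ≤ d := (ht₀.1.trans ht₀.2).le
  have h2 : BranchSign y c d c' d' (A (s₀ + ε)) ε 1 :=
    of_norm_lt hy hycc hydd fun t ht => hp.trans_le (hsep t ht).1
  have h3 : BranchSign y c d c' d' (A (s₀ - ε)) (-ε) 1 :=
    of_norm_lt hy hycc hydd fun t ht => hm.trans_le (by simpa using (hsep t ht).2)
  have h4 := (h2.trans h1).trans (h3.symm (by norm_num) hcd hc')
  have h5 := h4.affine hu (g t₀) (f := g) fun t => by simp only [hydef]; field_simp; ring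
  have h6 : ∀ s, g t₀ + u * A s = α s := fun s => by simp only [hAdef]; field_simp; ring
  rw [h6, h6] at h5
  simpa using h5

/-- The opposite orientation reduces to the previous one by reversing α about s₀, which exchanges
the two points. -/
lemma of_crosses_first {s₀ t₀ : ℝ} {u v : ℂ} (hc' : c' ≤ d')
    (hg : ContinuousOn g (Icc c d ∪ Icc c' d')) (hcc : g c = g c') (hdd : g d = g d')
    (ht₀ : t₀ ∈ Ioo c d) (ht₀' : t₀ ∉ Icc c' d')
    (hne : ∀ t ∈ Icc c d ∪ Icc c' d', t ≠ t₀ → g t ≠ g t₀) (hα : HasDerivAt α u s₀)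
    (hd : HasDerivAt g v t₀) (h0 : α s₀ = g t₀) (hv : (v / u).im ≠ 0) :
    ∀ᶠ ε : ℝ in 𝓝[>] 0, BranchSign g c d c' d' (α (s₀ + ε)) (α (s₀ - ε)) (-1) := by
  rcases lt_or_gt_of_ne hv with h | h
  · exact of_crosses_of_im_neg hc' hg hcc hdd ht₀ ht₀' hne hα hd h0 h
  · have hα' : HasDerivAt (fun s => α (2 * s₀ - s)) (-u) s₀ := by
      have h1 : HasDerivAt α u (2 * s₀ - s₀) := by
        rwa [show 2 * s₀ - s₀ = s₀ by ring]
      have := HasDerivAt.scomp (g₁ := α) s₀ h1 ((hasDerivAt_id s₀).const_sub (2 * s₀))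
      rwa [neg_one_smul] at this
    have := of_crosses_of_im_neg hc' hg hcc hdd ht₀ ht₀' hne hα' hd
      (by rw [← h0]; congr 1; ring) (by rw [div_neg, Complex.neg_im]; linarith)
    filter_upwards [this] with ε hε
    have := hε.symm (by norm_num) (ht₀.1.trans ht₀.2).le hc'
    rwa [show 2 * s₀ - (s₀ + ε) = s₀ - ε by ring, show 2 * s₀ - (s₀ - ε) = s₀ + ε by ring] at this

lemma of_crosses {s₀ t₀ : ℝ} {u v : ℂ} (hc : c ≤ d) (hc' : c' ≤ d')
    (hg : ContinuousOn g (Icc c d ∪ Icc c' d')) (hcc : g c = g c') (hdd : g d = g d')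
    (ht₀ : t₀ ∈ Ioo c d ∧ t₀ ∉ Icc c' d' ∨ t₀ ∈ Ioo c' d' ∧ t₀ ∉ Icc c d)
    (hne : ∀ t ∈ Icc c d ∪ Icc c' d', t ≠ t₀ → g t ≠ g t₀) (hα : HasDerivAt α u s₀)
    (hd : HasDerivAt g v t₀) (h0 : α s₀ = g t₀) (hv : (v / u).im ≠ 0) :
    ∀ᶠ ε : ℝ in 𝓝[>] 0, BranchSign g c d c' d' (α (s₀ + ε)) (α (s₀ - ε)) (-1) := by
  rcases ht₀ with h | h
  · exact of_crosses_first hc' hg hcc hdd h.1 h.2 hne hα hd h0 hv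
  · rw [union_comm] at hg hne
    filter_upwards [of_crosses_first hc hg hcc.symm hdd.symm h.1 h.2 hne hα hd h0 hv] with ε hε
    exact hε.swap (by norm_num)

lemma of_path_avoiding {p : ℝ → ℂ} (hc : c ≤ d) (hc' : c' ≤ d')
    (hg : ContinuousOn g (Icc c d ∪ Icc c' d')) (hcc : g c = g c') (hdd : g d = g d')
    (hab : a ≤ b) (hp : ContinuousOn p (Icc a b))
    (h : ∀ s ∈ Icc a b, ∀ t ∈ Icc c d ∪ Icc c' d', g t ≠ p s) :
    BranchSign g c d c' d' (p a) (p b) 1 := by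
  refine isPreconnected_Icc.induction₂ (fun x y => BranchSign g c d c' d' (p x) (p y) 1)
    (fun s hs => ?_) (fun x y z _ _ _ h₁ h₂ => by simpa using h₁.trans h₂)
    (fun x y _ _ h => h.symm (one_mul 1) hc hc') (left_mem_Icc.2 hab) (right_mem_Icc.2 hab)
  filter_upwards [(hp s hs).eventually (locally_one hg hcc hdd (h s hs))] with x hx
  exact hx.symm (one_mul 1) hc hc'

/-- Along a slightly translated path that crosses the closed curve at the times in `S`, the branch
changes sign once at each crossing. -/
lemma eventually_along_arc (hc : c ≤ d) (hc' : c' ≤ d')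
    (hg : ContinuousOn g (Icc c d ∪ Icc c' d')) (hcc : g c = g c') (hdd : g d = g d')
    (hab : a ≤ b) (hα : ContinuousOn α (Icc a b)) (S : Finset ℝ) (hS : ∀ s ∈ S, s ∈ Ioo a b)
    (hcross : ∀ s ∈ S, ∀ᶠ ε : ℝ in 𝓝[>] 0,
      BranchSign g c d c' d' (α (s + ε)) (α (s - ε)) (-1)) (e : ℂ)
    (hfree : ∀ s ∈ Icc a b, s ∉ S → ∀ t ∈ Icc c d ∪ Icc c' d',
      ∀ᶠ x : ℝ × ℝ × ℝ in 𝓝[>] 0 ×ˢ 𝓝 (s, t), x.2.1 ∈ Icc a b → x.2.2 ∈ Icc c d ∪ Icc c' d' →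
        g x.2.2 ≠ α x.2.1 + x.1 * e) :
    ∀ᶠ δ : ℝ in 𝓝[>] 0, BranchSign g c d c' d' (α a + δ * e) (α b + δ * e) ((-1) ^ S.card) := by
  set X := Icc c d ∪ Icc c' d' with hXdef
  have hX : IsCompact X := isCompact_Icc.union isCompact_Icc
  have hsmall : ∀ m : ℝ, 0 < m → ∀ᶠ ε : ℝ in 𝓝[>] 0, ε < m := fun m hm => by
    filter_upwards [Ioo_mem_nhdsGT hm] with ε hε using hε.2
  -- This ε isolates the crossings in disjoint intervals inside (a, b); it is fixed before the
  -- translation size δ.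
  obtain ⟨ε, hε, hεc, hεS, hεSS⟩ : ∃ ε : ℝ, 0 < ε ∧
      (∀ s ∈ S, BranchSign g c d c' d' (α (s + ε)) (α (s - ε)) (-1)) ∧
      (∀ s ∈ S, a < s - ε ∧ s + ε < b) ∧ ∀ s ∈ S, ∀ s' ∈ S, s < s' → s + ε < s' - ε := by
    refine (Eventually.and self_mem_nhdsWithin (((Filter.eventually_all_finset S).2 hcross).and
      (((Filter.eventually_all_finset S).2 fun s hs => ?_).and
      ((Filter.eventually_all_finset S).2 fun s hs => (Filter.eventually_all_finset S).2
        fun s' hs' => ?_)))).exists (f := 𝓝[>] (0 : ℝ))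
    · filter_upwards [hsmall (s - a) (sub_pos.2 (hS s hs).1),
        hsmall (b - s) (sub_pos.2 (hS s hs).2)] with ε h1 h2
      constructor <;> linarith
    · by_cases h : s < s'
      · filter_upwards [hsmall ((s' - s) / 2) (half_pos (sub_pos.2 h))] with ε h1 _
        linarith
      · exact Eventually.of_forall fun _ h' => absurd h' h
  set K := Icc a b \ ⋃ s ∈ S, Ioo (s - ε) (s + ε) with hKdef
  have hK : IsCompact K := isCompact_Icc.diff (isOpen_biUnion fun s _ => isOpen_Ioo)
  have hKS : ∀ s ∈ K, s ∉ S := fun s hs h => hs.2 (mem_biUnion h ⟨by linarith, by linarith⟩)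
  -- Compactness turns the pointwise avoidance in `hfree` into a single bound on δ valid for all of
  -- K and the whole curve.
  have hKev : ∀ᶠ δ : ℝ in 𝓝[>] 0, ∀ s ∈ K, ∀ t ∈ X, g t ≠ α s + δ * e := by
    have := (hK.prod hX).mem_prod_nhdsSet_of_forall (l := 𝓝[>] (0 : ℝ))
      (s := {x : ℝ × ℝ × ℝ | x.2.1 ∈ Icc a b → x.2.2 ∈ X → g x.2.2 ≠ α x.2.1 + x.1 * e})
      (fun x hx => hfree x.1 hx.1.1 (hKS _ hx.1) x.2 hx.2)
    have := (Filter.eventually_prod_iff.1 this)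
    obtain ⟨P, hP, Q, hQ, hPQ⟩ := this
    filter_upwards [hP] with δ hδ s hs t ht
    exact hPQ hδ (hQ.self_of_nhdsSet (s, t) ⟨hs, ht⟩) hs.1 ht
  have hshift : ∀ z : ℂ, (∀ t ∈ X, g t ≠ z) →
      ∀ᶠ δ : ℝ in 𝓝[>] 0, BranchSign g c d c' d' (z + δ * e) z 1 := fun z hz => by
    have ht : Tendsto (fun δ : ℝ => z + δ * e) (𝓝[>] 0) (𝓝 z) := by
      have : Continuous fun δ : ℝ => z + δ * e := by fun_prop
      simpa using (this.tendsto 0).mono_left nhdsWithin_le_nhds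
    exact ht.eventually (locally_one hg hcc hdd hz)
  -- The points α (s ± ε) lie off the curve, so a small shift of them does not alter the sign.
  have hSev : ∀ᶠ δ : ℝ in 𝓝[>] 0, ∀ s ∈ S,
      BranchSign g c d c' d' (α (s + ε) + δ * e) (α (s - ε) + δ * e) (-1) := by
    refine (Filter.eventually_all_finset S).2 fun s hs => ?_
    have h := hεc s hs
    have hz : ∀ t ∈ X, g t ≠ α (s + ε) ∧ g t ≠ α (s - ε) := by
      obtain ⟨r, _, hr, _⟩ := h
      exact fun t ht => ⟨(hr t ht).1, (hr t ht).2.1⟩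
    filter_upwards [hshift _ fun t ht => (hz t ht).1, hshift _ fun t ht => (hz t ht).2] with δ h1 h2
    have := (h1.trans h).trans (h2.symm (one_mul 1) hc hc')
    simpa using this
  filter_upwards [hKev, hSev] with δ hδK hδS
  set p : ℝ → ℂ := fun s => α s + δ * e with hp
  have hpc : ContinuousOn p (Icc a b) := hα.add continuousOn_const
  have hconn : ∀ x y, a ≤ x → y ≤ b → x ≤ y → (∀ s ∈ S, s + ε ≤ x ∨ y ≤ s - ε) →
      BranchSign g c d c' d' (p x) (p y) 1 := by
    intro x y hx hy hxy h
    refine of_path_avoiding hc hc' hg hcc hdd hxy (hpc.mono (Icc_subset_Icc hx hy)) fun s hs =>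
      hδK s ⟨⟨hx.trans hs.1, hs.2.trans hy⟩, fun hs' => ?_⟩
    obtain ⟨m, hm, h1, h2⟩ := mem_iUnion₂.1 hs'
    rcases h m hm with h | h
    · linarith [hs.1]
    · linarith [hs.2]
  have key : ∀ T : Finset ℝ, T ⊆ S → ∀ y, a ≤ y → y ≤ b → (∀ s ∈ T, s + ε ≤ y) →
      (∀ s ∈ S, s ∉ T → y ≤ s - ε) → BranchSign g c d c' d' (p a) (p y) ((-1) ^ T.card) := by
    intro T
    induction T using Finset.induction_on_max with
    | empty =>
      intro _ y hy hy' _ h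
      simpa using hconn a y le_rfl hy' hy fun s hs => Or.inr (h s hs (Finset.notMem_empty s))
    | insert m T hm ih =>
      intro hTS y hy hy' h1 h2
      have hmS : m ∈ S := hTS (Finset.mem_insert_self m T)
      have hT : T ⊆ S := (Finset.subset_insert m T).trans hTS
      have hmy := h1 m (Finset.mem_insert_self m T)
      have hmT : m ∉ T := fun h => lt_irrefl _ (hm m h)
      have hTm : ∀ s ∈ T, s + ε < m - ε := fun s hs => hεSS s (hT hs) m hmS (hm s hs)
      have i1 := ih hT (m - ε) (hεS m hmS).1.le (by linarith [(hεS m hmS).2])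
        (fun s hs => (hTm s hs).le) (fun s hs hsT => by
          by_cases hsm : s = m
          · rw [hsm]
          · have := h2 s hs (by simp [hsm, hsT])
            linarith)
      have i2 := (hδS m hmS).symm (by norm_num) hc hc'
      have i3 := hconn (m + ε) y (by linarith [(hεS m hmS).1]) hy' hmy fun s hs => by
        by_cases hsm : s = m
        · left; rw [hsm]
        · by_cases hsT : s ∈ T
          · left; linarith [hTm s hsT]
          · right; exact h2 s hs (by simp [hsm, hsT])
      have := (i1.trans i2).trans i3
      rw [Finset.card_insert_of_notMem hmT, pow_succ]
      simpa using this
  exact key S subset_rfl b hab le_rfl (fun s hs => (hεS s hs).2.le) fun s hs h => absurd hs h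

end BranchSign

/-! ### Parity of crossings of two closed curves -/

/-- Two closed curves, each made of a pair of arcs of `γ`, cross an even number of times. Besides
the transversal crossings `S` they may touch at points where locally the first curve stays in the
half plane `ℓ ≥ const` and the second one in `ℓ ≤ const`. -/
lemma even_card_of_arc_pairs {γ γ' : ℝ → ℂ} {a b a' b' c d c' d' : ℝ}
    (hγ : ∀ t, HasDerivAt γ (γ' t) t) (hab : a ≤ b) (hab' : a' ≤ b') (hcd : c ≤ d) (hcd' : c' ≤ d')
    (haa : γ a = γ a') (hbb : γ b = γ b') (hcc : γ c = γ c') (hdd : γ d = γ d')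
    (hA : Disjoint (Ioo a b) (Icc a' b')) (hA' : Disjoint (Icc a b) (Ioo a' b'))
    (hB : Disjoint (Ioo c d) (Icc c' d')) (hB' : Disjoint (Icc c d) (Ioo c' d'))
    (ℓ : ℂ →L[ℝ] ℝ) (hℓ : ℓ ≠ 0) (S : Finset ℝ)
    (hSA : ∀ s ∈ S, s ∈ Ioo a b ∪ Ioo a' b')
    (hS : ∀ s ∈ S, ∃ t ∈ Ioo c d ∪ Ioo c' d', γ s = γ t ∧ (γ' t / γ' s).im ≠ 0 ∧
      ∀ t' ∈ Icc c d ∪ Icc c' d', γ t' = γ t → t' = t)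
    (hcorner : ∀ s ∈ Icc a b ∪ Icc a' b', s ∉ S → ∀ t ∈ Icc c d ∪ Icc c' d', γ s = γ t →
      (∀ᶠ s' in 𝓝 s, s' ∈ Icc a b ∪ Icc a' b' → ℓ (γ s) ≤ ℓ (γ s')) ∧
      ∀ᶠ t' in 𝓝 t, t' ∈ Icc c d ∪ Icc c' d' → ℓ (γ t') ≤ ℓ (γ t)) :
    Even S.card := by
  classical
  obtain ⟨e, he⟩ : ∃ e, 0 < ℓ e := by
    obtain ⟨z, hz⟩ : ∃ z, ℓ z ≠ 0 := by
      by_contra! h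
      exact hℓ (ContinuousLinearMap.ext h)
    rcases lt_or_gt_of_ne hz with h | h
    · exact ⟨-z, by rw [map_neg]; linarith⟩
    · exact ⟨z, h⟩
  have hcont : Continuous γ := continuous_iff_continuousAt.2 fun t => (hγ t).continuousAt
  have hg : ContinuousOn γ (Icc c d ∪ Icc c' d') := hcont.continuousOn
  have hcross : ∀ s ∈ S, ∀ᶠ ε : ℝ in 𝓝[>] 0,
      BranchSign γ c d c' d' (γ (s + ε)) (γ (s - ε)) (-1) := by
    intro s hs
    obtain ⟨t, ht, hst, hv, huniq⟩ := hS s hs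
    refine BranchSign.of_crosses hcd hcd' hg hcc hdd ?_ (fun t' ht' hne h => hne (huniq t' ht' h))
      (hγ s) (hγ t) hst hv
    rcases ht with h | h
    · exact Or.inl ⟨h, fun h' => disjoint_left.1 hB h h'⟩
    · exact Or.inr ⟨h, fun h' => disjoint_left.1 hB' h' h⟩
  -- Translation by δ e raises ℓ on the first curve strictly above the touching value, while the
  -- second stays below it, so they separate there.
  have hfree : ∀ p q, Icc p q ⊆ Icc a b ∪ Icc a' b' → ∀ s ∈ Icc p q, s ∉ S →
      ∀ t ∈ Icc c d ∪ Icc c' d', ∀ᶠ x : ℝ × ℝ × ℝ in 𝓝[>] 0 ×ˢ 𝓝 (s, t), x.2.1 ∈ Icc p q →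
        x.2.2 ∈ Icc c d ∪ Icc c' d' → γ x.2.2 ≠ γ x.2.1 + x.1 * e := by
    intro p q hpq s hs hsS t ht
    by_cases hst : γ s = γ t
    · obtain ⟨h1, h2⟩ := hcorner s (hpq hs) hsS t ht hst
      have h0 : ∀ᶠ δ : ℝ in 𝓝[>] 0, 0 < δ := self_mem_nhdsWithin
      rw [nhds_prod_eq]
      filter_upwards [h0.prod_mk (h1.prod_mk h2)] with x hx hx1 hx2 hcon
      have i1 := hx.2.1 (hpq hx1)
      have i2 := hx.2.2 hx2
      have i3 : (x.1 : ℂ) * e = x.1 • e := (Complex.real_smul).symm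
      rw [hcon, i3, map_add, map_smul, smul_eq_mul, ← hst] at i2
      have := mul_pos hx.1 he
      linarith
    · have hF : Continuous fun x : ℝ × ℝ × ℝ => γ x.2.2 - (γ x.2.1 + x.1 * e) := by fun_prop
      have hlim : Tendsto (fun x : ℝ × ℝ × ℝ => γ x.2.2 - (γ x.2.1 + x.1 * e))
          (𝓝[>] 0 ×ˢ 𝓝 (s, t)) (𝓝 (γ t - (γ s + (0 : ℝ) * e))) := by
        refine (hF.tendsto (0, s, t)).mono_left ?_
        rw [nhds_prod_eq (x := (0 : ℝ))]
        exact Filter.prod_mono nhdsWithin_le_nhds le_rfl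
      have hne : γ t - (γ s + (0 : ℝ) * e) ≠ 0 := by
        simpa [sub_eq_zero] using fun h => hst (Eq.symm h)
      filter_upwards [hlim.eventually_ne hne] with x hx _ _
      exact sub_ne_zero.1 hx
  have h1 := BranchSign.eventually_along_arc hcd hcd' hg hcc hdd hab hcont.continuousOn
    (S.filter (· ∈ Ioo a b)) (fun s hs => (Finset.mem_filter.1 hs).2)
    (fun s hs => hcross s (Finset.mem_filter.1 hs).1) e
    (fun s hs hsS => hfree a b subset_union_left s hs fun h => hsS (Finset.mem_filter.2 ⟨h,
      (hSA s h).resolve_right fun h' => disjoint_left.1 hA' hs h'⟩))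
  have h2 := BranchSign.eventually_along_arc hcd hcd' hg hcc hdd hab' hcont.continuousOn
    (S.filter (· ∈ Ioo a' b')) (fun s hs => (Finset.mem_filter.1 hs).2)
    (fun s hs => hcross s (Finset.mem_filter.1 hs).1) e
    (fun s hs hsS => hfree a' b' subset_union_right s hs fun h => hsS (Finset.mem_filter.2 ⟨h,
      (hSA s h).resolve_left fun h' => disjoint_left.1 hA h' hs⟩))
  obtain ⟨δ, h1, h2⟩ := (h1.and h2).exists
  -- Both arcs lead from the same point to the same point, so going out along one and back along the
  -- other compares a point with itself.
  rw [← haa, ← hbb] at h2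
  have h3 := h1.trans (h2.symm (by rw [← mul_pow]; norm_num) hcd hcd')
  have h4 := h3.eq_one hcd hcd'
  rw [← pow_add, neg_one_pow_eq_one_iff_even (by norm_num)] at h4
  have hunion : S.filter (· ∈ Ioo a b) ∪ S.filter (· ∈ Ioo a' b') = S := by
    ext s
    simp only [Finset.mem_union, Finset.mem_filter, ← and_or_left]
    exact ⟨fun h => h.1, fun h => ⟨h, hSA s h⟩⟩
  have hdisj : Disjoint (S.filter (· ∈ Ioo a b)) (S.filter (· ∈ Ioo a' b')) := by
    rw [Finset.disjoint_left]
    intro s hs hs'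
    exact disjoint_left.1 hA (Finset.mem_filter.1 hs).2
      (Ioo_subset_Icc_self (Finset.mem_filter.1 hs').2)
  rwa [← Finset.card_union_of_disjoint hdisj, hunion] at h4

/-! ### From crossings of arcs to chords -/

/-- `γ` is a closed plane curve with velocity `γ'` whose crossings in the period `[w, w + 1)` are
traversed at the times `x k` and `y k`. -/
structure HasChordTimes {n : ℕ} (γ γ' : ℝ → ℂ) (w : ℝ) (x y : Fin n → ℝ) : Prop where
  periodic : Function.Periodic γ 1
  hasDerivAt : ∀ t, HasDerivAt γ (γ' t) t
  fst_mem : ∀ k, x k ∈ Ico w (w + 1)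
  snd_mem : ∀ k, y k ∈ Ico w (w + 1)
  fst_injective : Function.Injective x
  snd_injective : Function.Injective y
  fst_ne_snd : ∀ k l, x k ≠ y l
  eq_iff : ∀ s ∈ Ico w (w + 1), ∀ t ∈ Ico w (w + 1), s ≠ t →
    (γ s = γ t ↔ ∃ k, s = x k ∧ t = y k ∨ s = y k ∧ t = x k)
  transversal : ∀ k, (γ' (x k) / γ' (y k)).im ≠ 0 ∧ (γ' (y k) / γ' (x k)).im ≠ 0

namespace HasChordTimes

variable {n : ℕ} {γ γ' : ℝ → ℂ} {w : ℝ} {x y : Fin n → ℝ}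

lemma apply_fst_eq (h : HasChordTimes γ γ' w x y) (k : Fin n) : γ (x k) = γ (y k) :=
  (h.eq_iff _ (h.fst_mem k) _ (h.snd_mem k) (h.fst_ne_snd k k)).2 ⟨k, Or.inl ⟨rfl, rfl⟩⟩

/-- Transversal crossings of the two closed curves correspond to chords with one end in each. The
remaining coincidences are corners, which must be touching points. -/
lemma even_card_chords (h : HasChordTimes γ γ' w x y) {a b a' b' c d c' d' : ℝ}
    (hab : a ≤ b) (hab' : a' ≤ b') (hcd : c ≤ d) (hcd' : c' ≤ d')
    (haa : γ a = γ a') (hbb : γ b = γ b') (hcc : γ c = γ c') (hdd : γ d = γ d')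
    (hA : Disjoint (Ioo a b) (Icc a' b')) (hA' : Disjoint (Icc a b) (Ioo a' b'))
    (hB : Disjoint (Ioo c d) (Icc c' d')) (hB' : Disjoint (Icc c d) (Ioo c' d'))
    (hAw : Ioo a b ∪ Ioo a' b' ⊆ Ioo w (w + 1)) (hBw : Icc c d ∪ Icc c' d' ⊆ Icc w (w + 1))
    (hBw' : Ioo c d ∪ Ioo c' d' ⊆ Ioo w (w + 1))
    (hAB : Disjoint (Ioo a b ∪ Ioo a' b') (Icc c d ∪ Icc c' d'))
    (ℓ : ℂ →L[ℝ] ℝ) (hℓ : ℓ ≠ 0)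
    (hcorner : ∀ s ∈ Icc a b ∪ Icc a' b', ∀ t ∈ Icc c d ∪ Icc c' d', γ s = γ t →
      ¬ (s ∈ Ioo a b ∪ Ioo a' b' ∧ t ∈ Ioo c d ∪ Ioo c' d') →
      (∀ᶠ s' in 𝓝 s, s' ∈ Icc a b ∪ Icc a' b' → ℓ (γ s) ≤ ℓ (γ s')) ∧
      ∀ᶠ t' in 𝓝 t, t' ∈ Icc c d ∪ Icc c' d' → ℓ (γ t') ≤ ℓ (γ t))
    (C : Finset (Fin n)) (hC : ∀ k, k ∈ C ↔
      x k ∈ Ioo a b ∪ Ioo a' b' ∧ y k ∈ Ioo c d ∪ Ioo c' d' ∨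
      y k ∈ Ioo a b ∪ Ioo a' b' ∧ x k ∈ Ioo c d ∪ Ioo c' d') :
    Even C.card := by
  classical
  set A := Ioo a b ∪ Ioo a' b' with hAdef
  set B := Ioo c d ∪ Ioo c' d' with hBdef
  have hBX : B ⊆ Icc c d ∪ Icc c' d' := union_subset_union Ioo_subset_Icc_self Ioo_subset_Icc_self
  have hABo : ∀ s ∈ A, s ∉ B := fun s hs hs' => disjoint_left.1 hAB hs (hBX hs')
  -- For a chord in C this selects its unique end in A; the default `y k` is correct there because A
  -- and B are disjoint.
  set f : Fin n → ℝ := fun k => if x k ∈ A then x k else y k with hf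
  have hf1 : ∀ k, x k ∈ A → f k = x k := fun k hk => if_pos hk
  have hf2 : ∀ k, x k ∈ B → f k = y k := fun k hk => if_neg fun h => hABo _ h hk
  have hinj : Function.Injective f := by
    intro k l hkl
    simp only [hf] at hkl
    split_ifs at hkl
    · exact h.fst_injective hkl
    · exact absurd hkl (h.fst_ne_snd k l)
    · exact absurd hkl.symm (h.fst_ne_snd l k)
    · exact h.snd_injective hkl
  rw [← Finset.card_image_of_injective C hinj]
  have hmem : ∀ s ∈ C.image f, ∃ t ∈ B, s ∈ A ∧ γ s = γ t ∧ (γ' t / γ' s).im ≠ 0 ∧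
      ∃ k, s = x k ∧ t = y k ∨ s = y k ∧ t = x k := by
    intro s hs
    obtain ⟨k, hk, rfl⟩ := Finset.mem_image.1 hs
    rcases (hC k).1 hk with ⟨h1, h2⟩ | ⟨h1, h2⟩
    · rw [hf1 k h1]
      exact ⟨y k, h2, h1, h.apply_fst_eq k, (h.transversal k).2, k, Or.inl ⟨rfl, rfl⟩⟩
    · rw [hf2 k h2]
      exact ⟨x k, h2, h1, (h.apply_fst_eq k).symm, (h.transversal k).1, k, Or.inr ⟨rfl, rfl⟩⟩
  refine even_card_of_arc_pairs h.hasDerivAt hab hab' hcd hcd' haa hbb hcc hdd hA hA' hB hB' ℓ hℓ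
    _ (fun s hs => (hmem s hs).choose_spec.2.1) (fun s hs => ?_) (fun s hs hsS t ht hst =>
      hcorner s hs t ht hst fun hst' => hsS ?_)
  · obtain ⟨t, ht, hsA, hst, hv, k, hk⟩ := hmem s hs
    refine ⟨t, ht, hst, hv, fun t' ht' htt' => ?_⟩
    have huniq : ∀ τ ∈ Ico w (w + 1), τ ≠ s → γ τ = γ t → τ = t := by
      intro τ hτ hτs hτt
      obtain ⟨l, hl⟩ := (h.eq_iff s (Ioo_subset_Ico_self (hAw hsA)) τ hτ hτs.symm).1
        (hst.trans hτt.symm)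
      rcases hk with ⟨h1, h2⟩ | ⟨h1, h2⟩ <;> rcases hl with ⟨h3, h4⟩ | ⟨h3, h4⟩
      · rw [h4, h2, h.fst_injective (h3.symm.trans h1)]
      · exact absurd (h1.symm.trans h3) (h.fst_ne_snd _ _)
      · exact absurd (h3.symm.trans h1) (h.fst_ne_snd _ _)
      · rw [h4, h2, h.snd_injective (h3.symm.trans h1)]
    have ht's : t' ≠ s := fun h' => disjoint_left.1 hAB hsA (h' ▸ ht')
    -- The closed window contains w + 1, which represents the same circle point as w and falls
    -- outside `eq_iff`.
    rcases eq_or_lt_of_le (hBw ht').2 with h' | h'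
    · have h1 : γ w = γ t := by rw [← htt', h', h.periodic]
      have h2 := huniq w ⟨le_rfl, by linarith⟩ (hAw hsA).1.ne h1
      exact absurd h2 (hBw' ht).1.ne
    · exact huniq t' ⟨(hBw ht').1, h'⟩ ht's htt'
  · have hne : s ≠ t := fun h' => hABo s hst'.1 (h' ▸ hst'.2)
    obtain ⟨k, hk⟩ := (h.eq_iff s (Ioo_subset_Ico_self (hAw hst'.1)) t
      (Ioo_subset_Ico_self (hBw' hst'.2)) hne).1 hst
    refine Finset.mem_image.2 ⟨k, ?_⟩
    rcases hk with ⟨h1, h2⟩ | ⟨h1, h2⟩ <;> rw [h1, h2] at hst'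
    · exact ⟨(hC k).2 (Or.inl hst'), by rw [hf1 k hst'.1, h1]⟩
    · exact ⟨(hC k).2 (Or.inr hst'), by rw [hf2 k hst'.2, h1]⟩

end HasChordTimes

lemma Complex.im_div_ne_zero_of_linearIndependent {E : Type*} [AddCommGroup E] [Module ℝ E]
    (Φ : E ≃ₗ[ℝ] ℂ) {u v : E} (h : LinearIndependent ℝ ![u, v]) : (Φ v / Φ u).im ≠ 0 := by
  intro h0
  have hu : Φ u ≠ 0 := by
    intro hu
    exact h.ne_zero 0 (by simpa using hu)
  have h1 : Φ v = (Φ v / Φ u).re • Φ u := by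
    rw [Complex.real_smul]
    have : (((Φ v / Φ u).re : ℝ) : ℂ) = Φ v / Φ u := Complex.ext (by simp) (by simp [h0])
    rw [this]; field_simp
  have h2 : (Φ v / Φ u).re • u + (-1 : ℝ) • v = 0 := by
    apply Φ.injective
    rw [map_add, map_smul, map_smul, ← h1]; simp
  have := (LinearIndependent.pair_iff.1 h _ _ h2).2
  norm_num at this

namespace GaussDiagram

variable {n : ℕ}

lemma exists_endpoints (G : GaussDiagram n) : ∃ lo hi : Fin n → Fin (2 * n),
    (∀ k, lo k < hi k) ∧ ∀ p k, G.word p = k ↔ p = lo k ∨ p = hi k := by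
  have : ∀ k, ∃ p q : Fin (2 * n), p < q ∧ ∀ s, G.word s = k ↔ s = p ∨ s = q := by
    intro k
    obtain ⟨p, q, hpq, h⟩ := Finset.card_eq_two.1 (G.card_eq_two k)
    have h' : ∀ s, G.word s = k ↔ s = p ∨ s = q := fun s => by
      have := congrArg (s ∈ ·) h
      simpa using this
    rcases lt_or_gt_of_ne hpq with hlt | hlt
    · exact ⟨p, q, hlt, h'⟩
    · exact ⟨q, p, hlt, fun s => (h' s).trans or_comm⟩
  choose lo hi h1 h2 using this
  exact ⟨lo, hi, h1, fun p k => h2 k p⟩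

lemma crosses_iff {G : GaussDiagram n} {lo hi : Fin n → Fin (2 * n)} (hlt : ∀ k, lo k < hi k)
    (hw : ∀ p k, G.word p = k ↔ p = lo k ∨ p = hi k) (k l : Fin n) :
    G.Crosses k l ↔ lo k < lo l ∧ lo l < hi k ∧ hi k < hi l ∨
      lo l < lo k ∧ lo k < hi l ∧ hi l < hi k := by
  have key : ∀ {p q m}, p < q → G.word p = m → G.word q = m → p = lo m ∧ q = hi m := by
    intro p q m hpq hp hq
    have := hlt m
    rcases (hw _ _).1 hp with h | h <;> rcases (hw _ _).1 hq with h' | h' <;> subst h h'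
    · exact absurd hpq (lt_irrefl _)
    · exact ⟨rfl, rfl⟩
    · exact absurd (hpq.trans this) (lt_irrefl _)
    · exact absurd hpq (lt_irrefl _)
  constructor
  · rintro ⟨p, q, r, s, hpq, hqr, hrs, ⟨h1, h2, h3, h4⟩ | ⟨h1, h2, h3, h4⟩⟩
    · obtain ⟨rfl, rfl⟩ := key (hpq.trans hqr) h1 h3
      obtain ⟨rfl, rfl⟩ := key (hqr.trans hrs) h2 h4
      exact Or.inl ⟨hpq, hqr, hrs⟩
    · obtain ⟨rfl, rfl⟩ := key (hpq.trans hqr) h1 h3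
      obtain ⟨rfl, rfl⟩ := key (hqr.trans hrs) h2 h4
      exact Or.inr ⟨hpq, hqr, hrs⟩
  · have hl : ∀ m, G.word (lo m) = m := fun m => (hw _ _).2 (Or.inl rfl)
    have hh : ∀ m, G.word (hi m) = m := fun m => (hw _ _).2 (Or.inr rfl)
    rintro (⟨h1, h2, h3⟩ | ⟨h1, h2, h3⟩)
    · exact ⟨_, _, _, _, h1, h2, h3, Or.inl ⟨hl k, hl l, hh k, hh l⟩⟩
    · exact ⟨_, _, _, _, h1, h2, h3, Or.inr ⟨hl l, hl k, hh l, hh k⟩⟩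

/-- Identifying the plane with ℂ makes square roots available and turns transversality into a
nonreal quotient of velocities. -/
lemma Realizable.exists_chordTimes {G : GaussDiagram n} (hG : G.Realizable) :
    ∃ (γ γ' : ℝ → ℂ) (x y : Fin n → ℝ), HasChordTimes γ γ' 0 x y ∧ (∀ k, x k < y k) ∧
      ∀ k l, G.Crosses k l ↔ x k < x l ∧ x l < y k ∧ y k < y l ∨
        x l < x k ∧ x k < y l ∧ y l < y k := by
  obtain ⟨γ, hγ, t, ht, hrange, hword⟩ := hG
  obtain ⟨lo, hi, hlt, hw⟩ := G.exists_endpoints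
  set Φ := Complex.orthonormalBasisOneI.repr.symm
  have hl : ∀ m, G.word (lo m) = m := fun m => (hw _ _).2 (Or.inl rfl)
  have hh : ∀ m, G.word (hi m) = m := fun m => (hw _ _).2 (Or.inr rfl)
  have hmem : ∀ p, t p ∈ Ico (0 : ℝ) 1 := fun p =>
    (hrange ▸ mem_range_self p : t p ∈ crossingTimes γ).1
  have heq : ∀ k, γ (t (lo k)) = γ (t (hi k)) := fun k => (hword _ _).2 (by rw [hl, hh])
  refine ⟨fun s => Φ (γ s), fun s => Φ (deriv γ s), fun k => t (lo k), fun k => t (hi k),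
    ⟨fun s => by simp only [hγ.periodic s], fun s => ?_, fun k => ?_, fun k => ?_, ?_, ?_, ?_, ?_,
      fun k => ⟨?_, ?_⟩⟩, fun k => ht (hlt k), fun k l => ?_⟩
  · have h1 : HasDerivAt γ (deriv γ s) s :=
      ((hγ.contDiff.differentiable (by norm_num)) s).hasDerivAt
    exact (Φ.toContinuousLinearEquiv : _ →L[ℝ] ℂ).hasFDerivAt.comp_hasDerivAt s h1
  · simpa using hmem (lo k)
  · simpa using hmem (hi k)
  · intro k l hkl
    rw [← hl k, ← hl l, ht.injective hkl]
  · intro k l hkl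
    rw [← hh k, ← hh l, ht.injective hkl]
  · intro k l hkl
    have h1 := ht.injective hkl
    have h2 : k = l := by rw [← hl k, ← hh l, h1]
    subst h2
    exact (hlt k).ne h1
  · intro s hs s' hs' hne
    rw [zero_add] at hs hs'
    simp only [EmbeddingLike.apply_eq_iff_eq]
    constructor
    · intro h
      have h1 : s ∈ crossingTimes γ := ⟨hs, s', hs', hne.symm, h.symm⟩
      have h2 : s' ∈ crossingTimes γ := ⟨hs', s, hs, hne, h⟩
      rw [← hrange] at h1 h2
      obtain ⟨p, rfl⟩ := h1
      obtain ⟨q, rfl⟩ := h2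
      refine ⟨G.word p, ?_⟩
      rcases (hw p (G.word p)).1 rfl with hp | hp <;>
        rcases (hw q (G.word p)).1 ((hword p q).1 h).symm with hq | hq
      · exact absurd (congrArg t (hp.trans hq.symm)) hne
      · exact Or.inl ⟨congrArg t hp, congrArg t hq⟩
      · exact Or.inr ⟨congrArg t hp, congrArg t hq⟩
      · exact absurd (congrArg t (hp.trans hq.symm)) hne
    · rintro ⟨k, ⟨rfl, rfl⟩ | ⟨rfl, rfl⟩⟩
      · exact heq k
      · exact (heq k).symm
  · exact Complex.im_div_ne_zero_of_linearIndependent Φ.toLinearEquiv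
      (hγ.transversal _ (hmem _) _ (hmem _) (ht (hlt k)).ne' (heq k).symm)
  · exact Complex.im_div_ne_zero_of_linearIndependent Φ.toLinearEquiv
      (hγ.transversal _ (hmem _) _ (hmem _) (ht (hlt k)).ne (heq k))
  · simp only [ht.lt_iff_lt]
    exact crosses_iff hlt hw k l

end GaussDiagram

namespace HasChordTimes

variable {n : ℕ} {γ γ' : ℝ → ℂ} {w : ℝ} {x y : Fin n → ℝ}

lemma periodic_deriv (h : HasChordTimes γ γ' w x y) : Function.Periodic γ' 1 := fun t => by
  have h1 := (h.hasDerivAt (t + 1)).comp_add_const t 1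
  rw [show (fun s => γ (s + 1)) = γ from funext h.periodic] at h1
  exact h1.unique (h.hasDerivAt t)

/-- Move the base point of the period from `0` to `w`. -/
lemma shift (h : HasChordTimes γ γ' 0 x y) (hw : w ∈ Ico (0 : ℝ) 1) :
    HasChordTimes γ γ' w (fun k => if x k < w then x k + 1 else x k)
      (fun k => if y k < w then y k + 1 else y k) := by
  set σ : ℝ → ℝ := fun s => if s < w then s + 1 else s with hσ
  have hmem : ∀ s ∈ Ico (0 : ℝ) (0 + 1), σ s ∈ Ico w (w + 1) := by
    rintro s ⟨h1, h2⟩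
    simp only [hσ]
    split_ifs with h3
    · exact ⟨by linarith [hw.2], by linarith⟩
    · exact ⟨not_lt.1 h3, by linarith [hw.1]⟩
  have hinj : ∀ s ∈ Ico (0 : ℝ) (0 + 1), ∀ s' ∈ Ico (0 : ℝ) (0 + 1), σ s = σ s' → s = s' := by
    rintro s ⟨h1, h2⟩ s' ⟨h3, h4⟩ h5
    simp only [hσ] at h5
    split_ifs at h5 <;> linarith
  have hsurj : ∀ s ∈ Ico w (w + 1), ∃ s' ∈ Ico (0 : ℝ) (0 + 1), s = σ s' := by
    rintro s ⟨h1, h2⟩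
    rcases lt_or_ge s 1 with h3 | h3
    · exact ⟨s, ⟨hw.1.trans h1, by linarith⟩, by simp [hσ, not_lt.2 h1]⟩
    · refine ⟨s - 1, ⟨by linarith, by linarith [hw.2]⟩, ?_⟩
      simp only [hσ]
      rw [if_pos (by linarith)]; ring
  have hval : ∀ s, γ (σ s) = γ s ∧ γ' (σ s) = γ' s := fun s => by
    simp only [hσ]
    split_ifs
    · exact ⟨h.periodic s, h.periodic_deriv s⟩
    · exact ⟨rfl, rfl⟩
  refine ⟨h.periodic, h.hasDerivAt, fun k => hmem _ (h.fst_mem k), fun k => hmem _ (h.snd_mem k),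
    fun k l hkl => h.fst_injective (hinj _ (h.fst_mem k) _ (h.fst_mem l) hkl),
    fun k l hkl => h.snd_injective (hinj _ (h.snd_mem k) _ (h.snd_mem l) hkl),
    fun k l hkl => h.fst_ne_snd k l (hinj _ (h.fst_mem k) _ (h.snd_mem l) hkl), ?_, fun k => ?_⟩
  · intro s hs t ht hne
    obtain ⟨s', hs', rfl⟩ := hsurj s hs
    obtain ⟨t', ht', rfl⟩ := hsurj t ht
    rw [(hval _).1, (hval _).1, h.eq_iff s' hs' t' ht' fun h' => hne (congrArg σ h')]
    refine exists_congr fun k => or_congr (and_congr ?_ ?_) (and_congr ?_ ?_)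
    · exact ⟨congrArg σ, hinj _ hs' _ (h.fst_mem k)⟩
    · exact ⟨congrArg σ, hinj _ ht' _ (h.snd_mem k)⟩
    · exact ⟨congrArg σ, hinj _ hs' _ (h.snd_mem k)⟩
    · exact ⟨congrArg σ, hinj _ ht' _ (h.fst_mem k)⟩
  · have := h.transversal k
    rw [← (hval (x k)).2, ← (hval (y k)).2] at this
    exact this

/-- The only times at which the curve visits a given crossing. -/
lemma eq_or_of_apply_eq {i : Fin n} (h : HasChordTimes γ γ' (x i) x y) (k : Fin n) {t : ℝ}
    (ht : t ∈ Icc (x i) (x i + 1)) (hk : γ t = γ (x k)) :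
    t = x k ∨ t = y k ∨ k = i ∧ t = x i + 1 := by
  have key : ∀ t ∈ Ico (x i) (x i + 1), γ t = γ (x k) → t = x k ∨ t = y k := by
    intro t ht hk
    by_contra! hne
    obtain ⟨l, ⟨h1, h2⟩ | ⟨h1, h2⟩⟩ := (h.eq_iff t ht (x k) (h.fst_mem k) hne.1).1 hk
    · exact h.fst_ne_snd _ _ h2
    · exact hne.2 (h1.trans (by rw [h.fst_injective h2]))
  rcases eq_or_lt_of_le ht.2 with h' | h'
  · rw [h', h.periodic] at hk
    rcases key (x i) ⟨le_rfl, by linarith⟩ hk with h1 | h1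
    · exact Or.inr (Or.inr ⟨(h.fst_injective h1).symm, h'⟩)
    · exact absurd h1 (h.fst_ne_snd _ _)
  · rcases key t ⟨ht.1, h'⟩ hk with h1 | h1
    · exact Or.inl h1
    · exact Or.inr (Or.inl h1)

end HasChordTimes

/-! ### Closed curves cut from the plane curve -/

lemma exists_realLinear_of_im_div_ne_zero {u v : ℂ} (h : (v / u).im ≠ 0) (σ : ℝ) :
    ∃ ℓ : ℂ →L[ℝ] ℝ, ℓ u = 1 ∧ ℓ v = σ := by
  have hu : u ≠ 0 := by rintro rfl; simp at h
  -- The functional z ↦ Re (z / u) + λ Im (z / u) is 1 at u, and λ is solved from the value σ at v.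
  refine ⟨(Complex.reCLM + ((σ - (v / u).re) / (v / u).im) • Complex.imCLM).comp
    (ContinuousLinearMap.mul ℝ ℂ u⁻¹), ?_, ?_⟩
  · simp [hu]
  · have : u⁻¹ * v = v / u := by field_simp
    simp only [ContinuousLinearMap.comp_apply, ContinuousLinearMap.mul_apply', this]
    simp only [add_apply, smul_apply, Complex.reCLM_apply,
      Complex.imCLM_apply, smul_eq_mul]
    field_simp; ring

lemma HasDerivAt.eventually_le_of_pos {p : ℝ → ℝ} {m t : ℝ} (hp : HasDerivAt p m t) (hm : 0 < m) :
    ∀ᶠ s in 𝓝 t, (t ≤ s → p t ≤ p s) ∧ (s ≤ t → p s ≤ p t) := by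
  have := (hasDerivAt_iff_tendsto_slope.1 hp).eventually (lt_mem_nhds hm)
  rw [eventually_nhdsWithin_iff] at this
  filter_upwards [this] with s hs
  by_cases hst : s = t
  · subst hst; simp
  have h1 := hs hst
  have h2 : p s - p t = (s - t) * slope p t s := by
    have := sub_smul_slope p t s
    rw [vsub_eq_sub, smul_eq_mul] at this
    exact this.symm
  constructor <;> intro h <;> nlinarith

lemma HasDerivAt.eventually_le_of_neg {p : ℝ → ℝ} {m t : ℝ} (hp : HasDerivAt p m t) (hm : m < 0) :
    ∀ᶠ s in 𝓝 t, (s ≤ t → p t ≤ p s) ∧ (t ≤ s → p s ≤ p t) := by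
  filter_upwards [hp.neg.eventually_le_of_pos (neg_pos.2 hm)] with s hs
  simp only [Pi.neg_apply, neg_le_neg_iff] at hs
  exact ⟨hs.2, hs.1⟩

namespace HasChordTimes

variable {n : ℕ} {γ γ' : ℝ → ℂ} {x y : Fin n → ℝ} {i j k : Fin n}

lemma hasDerivAt_functional {w : ℝ} (h : HasChordTimes γ γ' w x y) (ℓ : ℂ →L[ℝ] ℝ) (t : ℝ) :
    HasDerivAt (fun s => ℓ (γ s)) (ℓ (γ' t)) t :=
  ℓ.hasFDerivAt.comp_hasDerivAt t (h.hasDerivAt t)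

/-- Two disjoint loops meeting only transversally cross an even number of times. -/
lemma even_card_of_disjoint_loops {w : ℝ} (h : HasChordTimes γ γ' w x y) {a b c d : ℝ}
    (hwa : w ≤ a) (hab : a < b) (hbc : b < c) (hcd : c < d) (hdw : d ≤ w + 1)
    (hγab : γ a = γ b) (hγcd : γ c = γ d)
    (hint : ∀ s ∈ Icc a b, ∀ t ∈ Icc c d, γ s = γ t → s ∈ Ioo a b ∧ t ∈ Ioo c d)
    (C : Finset (Fin n)) (hC : ∀ k, k ∈ C ↔
      x k ∈ Ioo a b ∧ y k ∈ Ioo c d ∨ y k ∈ Ioo a b ∧ x k ∈ Ioo c d) :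
    Even C.card := by
  obtain ⟨ℓ, hℓ⟩ : ∃ ℓ : ℂ →L[ℝ] ℝ, ℓ ≠ 0 :=
    ⟨Complex.reCLM, fun h => by simpa using congrArg (fun ℓ : ℂ →L[ℝ] ℝ => ℓ 1) h⟩
  have hIa : Ioo a b ∪ Ioo a a = Ioo a b := by simp
  have hIc : Ioo c d ∪ Ioo c c = Ioo c d := by simp
  have hJa : Icc a b ∪ Icc a a = Icc a b := by simp [hab.le]
  have hJc : Icc c d ∪ Icc c c = Icc c d := by simp [hcd.le]
  refine h.even_card_chords (a := a) (b := b) (a' := a) (b' := a) (c := c) (d := d) (c' := c)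
    (d' := c) hab.le le_rfl hcd.le le_rfl rfl hγab.symm rfl hγcd.symm (by simp) (by simp) (by simp)
    (by simp) ?_ ?_ ?_ ?_ ℓ hℓ ?_ C (by rwa [hIa, hIc])
  · rw [hIa]; exact fun s hs => ⟨by linarith [hs.1], by linarith [hs.2]⟩
  · rw [hJc]; exact fun s hs => ⟨by linarith [hs.1], by linarith [hs.2]⟩
  · rw [hIc]; exact fun s hs => ⟨by linarith [hs.1], by linarith [hs.2]⟩
  · rw [hIa, hJc]; exact disjoint_left.2 fun s hs hs' => by linarith [hs.2, hs'.1]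
  · rw [hIa, hIc, hJa, hJc]
    exact fun s hs t ht hst hn => absurd (hint s hs t ht hst) hn

/-- A chord crosses an even number of other chords: the two loops at a crossing touch there
without crossing. -/
lemma even_card_of_complementary_loops (h : HasChordTimes γ γ' (x i) x y) (hi : x i < y i)
    (C : Finset (Fin n)) (hC : ∀ k, k ∈ C ↔
      x k ∈ Ioo (x i) (y i) ∧ y k ∈ Ioo (y i) (x i + 1) ∨
      y k ∈ Ioo (x i) (y i) ∧ x k ∈ Ioo (y i) (x i + 1)) :
    Even C.card := by
  -- With velocities of opposite ℓ-sign, the loop leaving at x i and arriving at y i has both ends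
  -- in ℓ ≥ const, and the complementary loop has both in ℓ ≤ const.
  obtain ⟨ℓ, hℓ1, hℓ2⟩ := exists_realLinear_of_im_div_ne_zero (h.transversal i).2 (-1)
  have hℓ : ℓ ≠ 0 := by rintro rfl; simp at hℓ1
  have hy1 := (h.snd_mem i).2
  have hw1 : γ (x i + 1) = γ (x i) := h.periodic _
  have hxy := h.apply_fst_eq i
  have hIa : ∀ p q : ℝ, Ioo p q ∪ Ioo p p = Ioo p q := by simp
  have hJa : ∀ p q : ℝ, p ≤ q → Icc p q ∪ Icc p p = Icc p q := fun p q h => by simp [h]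
  refine h.even_card_chords (a := x i) (b := y i) (a' := x i) (b' := x i) (c := y i)
    (d := x i + 1) (c' := y i) (d' := y i) hi.le le_rfl hy1.le le_rfl rfl hxy.symm
    rfl (hw1.trans hxy) (by simp) (by simp) (by simp)
    (by simp) ?_ ?_ ?_ ?_ ℓ hℓ ?_ C (by simpa only [hIa] using hC)
  · rw [hIa]; exact fun s hs => ⟨hs.1, hs.2.trans hy1⟩
  · rw [hJa _ _ hy1.le]; exact fun s hs => ⟨hi.le.trans hs.1, hs.2⟩
  · rw [hIa]; exact fun s hs => ⟨hi.trans hs.1, hs.2⟩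
  · rw [hIa, hJa _ _ hy1.le]; exact disjoint_left.2 fun s hs hs' => by linarith [hs.2, hs'.1]
  rw [hIa, hIa, hJa _ _ hi.le, hJa _ _ hy1.le]
  intro s hs t ht hst hn
  have hsw : s ∈ Icc (x i) (x i + 1) := ⟨hs.1, hs.2.trans hy1.le⟩
  have htw : t ∈ Icc (x i) (x i + 1) := ⟨hi.le.trans ht.1, ht.2⟩
  have hval : γ s = γ (x i) := by
    by_cases hs' : s ∈ Ioo (x i) (y i)
    · have : t = y i ∨ t = x i + 1 := by
        by_contra! hcon
        exact hn ⟨hs', lt_of_le_of_ne ht.1 hcon.1.symm, lt_of_le_of_ne ht.2 hcon.2⟩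
      rcases this with rfl | rfl
      · rw [hst, hxy]
      · rw [hst, hw1]
    · rcases eq_or_lt_of_le hs.1 with h1 | h1
      · rw [← h1]
      · rcases eq_or_lt_of_le hs.2 with h2 | h2
        · rw [h2, hxy]
        · exact absurd ⟨h1, h2⟩ hs'
  have hs' : s = x i ∨ s = y i := by
    rcases h.eq_or_of_apply_eq i hsw hval with h1 | h1 | ⟨-, h1⟩
    · exact Or.inl h1
    · exact Or.inr h1
    · linarith [hs.2]
  have ht' : t = y i ∨ t = x i + 1 := by
    rcases h.eq_or_of_apply_eq i htw (hst.symm.trans hval) with h1 | h1 | ⟨-, h1⟩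
    · linarith [ht.1]
    · exact Or.inl h1
    · exact Or.inr h1
  have dx := (h.hasDerivAt_functional ℓ (x i)).eventually_le_of_pos (by rw [hℓ1]; norm_num)
  have dy := (h.hasDerivAt_functional ℓ (y i)).eventually_le_of_neg (by rw [hℓ2]; norm_num)
  have dw := (h.hasDerivAt_functional ℓ (x i + 1)).eventually_le_of_pos
    (by rw [h.periodic_deriv, hℓ1]; norm_num)
  constructor
  · rcases hs' with rfl | rfl
    · filter_upwards [dx] with s' hs' hm using hs'.1 hm.1
    · filter_upwards [dy] with s' hs' hm using hs'.1 hm.2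
  · rcases ht' with rfl | rfl
    · filter_upwards [dy] with t' ht' hm using ht'.2 hm.1
    · filter_upwards [dw] with t' ht' hm using ht'.2 hm.2

/-- For three pairwise intersecting chords, two of the closed curves formed by pairs of opposite
arcs cross an even number of times. -/
lemma even_card_of_bigons (h : HasChordTimes γ γ' (x i) x y) (hij : x i < x j) (hjk : x j < x k)
    (hki : x k < y i) (hij' : y i < y j) (hjk' : y j < y k)
    (C : Finset (Fin n)) (hC : ∀ l, l ∈ C ↔
      x l ∈ Ioo (x i) (x j) ∪ Ioo (y i) (y j) ∧ y l ∈ Ioo (x k) (y i) ∪ Ioo (y k) (x i + 1) ∨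
      y l ∈ Ioo (x i) (x j) ∪ Ioo (y i) (y j) ∧ x l ∈ Ioo (x k) (y i) ∪ Ioo (y k) (x i + 1)) :
    Even C.card := by
  -- Both arcs of the first curve leave the crossing i and both arcs of the second arrive there, so
  -- ℓ is made to increase along both branches.
  obtain ⟨ℓ, hℓ1, hℓ2⟩ := exists_realLinear_of_im_div_ne_zero (h.transversal i).2 1
  have hℓ : ℓ ≠ 0 := by rintro rfl; simp at hℓ1
  have hy1 := (h.snd_mem k).2
  have hw1 : γ (x i + 1) = γ (x i) := h.periodic _
  have hxi := h.apply_fst_eq i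
  have hxj := h.apply_fst_eq j
  have hxk := h.apply_fst_eq k
  have hji : j ≠ i := by rintro rfl; exact lt_irrefl _ hij
  have hki' : k ≠ i := by rintro rfl; linarith
  refine h.even_card_chords hij.le hij'.le hki.le hy1.le hxi hxj hxk (hxi.symm.trans hw1.symm)
    ?_ ?_ ?_ ?_ ?_ ?_ ?_ ?_ ℓ hℓ ?_ C hC
  · exact disjoint_left.2 fun s hs hs' => by linarith [hs.2, hs'.1]
  · exact disjoint_left.2 fun s hs hs' => by linarith [hs.2, hs'.1]
  · exact disjoint_left.2 fun s hs hs' => by linarith [hs.2, hs'.1]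
  · exact disjoint_left.2 fun s hs hs' => by linarith [hs.2, hs'.1]
  · rintro s (hs | hs) <;> constructor <;> linarith [hs.1, hs.2]
  · rintro s (hs | hs) <;> constructor <;> linarith [hs.1, hs.2]
  · rintro s (hs | hs) <;> constructor <;> linarith [hs.1, hs.2]
  · refine disjoint_left.2 ?_
    rintro s (hs | hs) (hs' | hs') <;> linarith [hs.1, hs.2, hs'.1, hs'.2]
  intro s hs t ht hst hn
  have hsw : s ∈ Icc (x i) (x i + 1) := by
    rcases hs with hs | hs <;> constructor <;> linarith [hs.1, hs.2]
  have htw : t ∈ Icc (x i) (x i + 1) := by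
    rcases ht with ht | ht <;> constructor <;> linarith [ht.1, ht.2]
  -- The only corner shared by the two curves is i: neither time of j lies on the second curve and
  -- neither time of k on the first.
  have hval : γ s = γ (x i) := by
    have h1 : (s = x i ∨ s = y i) ∨ (s = x j ∨ s = y j) ∨ s ∈ Ioo (x i) (x j) ∪ Ioo (y i) (y j) := by
      simp only [mem_union, mem_Icc, mem_Ioo] at hs ⊢
      grind
    have h2 : (t = y i ∨ t = x i + 1) ∨ (t = x k ∨ t = y k) ∨
        t ∈ Ioo (x k) (y i) ∪ Ioo (y k) (x i + 1) := by
      simp only [mem_union, mem_Icc, mem_Ioo] at ht ⊢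
      grind
    rcases h1 with (h1 | h1) | h1 | h1
    · rw [h1]
    · rw [h1, hxi]
    · have hj : γ t = γ (x j) := by
        rcases h1 with h1 | h1
        · rw [← hst, h1]
        · rw [← hst, h1, hxj]
      rcases h.eq_or_of_apply_eq j htw hj with h3 | h3 | ⟨h3, -⟩
      · rcases ht with ht | ht <;> linarith [ht.1]
      · rcases ht with ht | ht <;> linarith [ht.1, ht.2]
      · exact absurd h3 hji
    · rcases h2 with (h2 | h2) | h2 | h2
      · rw [hst, h2, hxi]
      · rw [hst, h2, hw1]
      · have hk : γ s = γ (x k) := by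
          rcases h2 with h2 | h2
          · rw [hst, h2]
          · rw [hst, h2, hxk]
        rcases h.eq_or_of_apply_eq k hsw hk with h3 | h3 | ⟨h3, -⟩
        · rcases hs with hs | hs <;> linarith [hs.1, hs.2]
        · rcases hs with hs | hs <;> linarith [hs.1, hs.2]
        · exact absurd h3 hki'
      · exact absurd ⟨h1, h2⟩ hn
  have hs' : s = x i ∨ s = y i := by
    rcases h.eq_or_of_apply_eq i hsw hval with h1 | h1 | ⟨-, h1⟩
    · exact Or.inl h1
    · exact Or.inr h1
    · rcases hs with hs | hs <;> linarith [hs.2]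
  have ht' : t = y i ∨ t = x i + 1 := by
    rcases h.eq_or_of_apply_eq i htw (hst.symm.trans hval) with h1 | h1 | ⟨-, h1⟩
    · rcases ht with ht | ht <;> linarith [ht.1]
    · exact Or.inl h1
    · exact Or.inr h1
  have dx := (h.hasDerivAt_functional ℓ (x i)).eventually_le_of_pos (by rw [hℓ1]; norm_num)
  have dy := (h.hasDerivAt_functional ℓ (y i)).eventually_le_of_pos (by rw [hℓ2]; norm_num)
  have dw := (h.hasDerivAt_functional ℓ (x i + 1)).eventually_le_of_pos
    (by rw [h.periodic_deriv, hℓ1]; norm_num)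
  constructor
  · rcases hs' with rfl | rfl
    · filter_upwards [dx] with s' hs' hm
      exact hs'.1 (by rcases hm with hm | hm <;> linarith [hm.1])
    -- Staying beyond x j keeps s' off the other arc of the pair, so s' ≥ y i.
    · filter_upwards [dy, lt_mem_nhds (hjk.trans hki)] with s' hs' hlt hm
      exact hs'.1 (by rcases hm with hm | hm <;> linarith [hm.1, hm.2])
  · rcases ht' with rfl | rfl
    · filter_upwards [dy, gt_mem_nhds (hij'.trans hjk')] with t' ht' hlt hm
      exact ht'.2 (by rcases hm with hm | hm <;> linarith [hm.1, hm.2])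
    · filter_upwards [dw] with t' ht' hm
      exact ht'.2 (by rcases hm with hm | hm <;> linarith [hm.1, hm.2])

end HasChordTimes

/-! ### Counting chords modulo 2 -/

namespace GaussDiagram

variable {n : ℕ} {G : GaussDiagram n}

lemma Crosses.symm {i j : Fin n} (h : G.Crosses i j) : G.Crosses j i := by
  obtain ⟨p, q, r, s, hpq, hqr, hrs, h⟩ := h
  exact ⟨p, q, r, s, hpq, hqr, hrs, h.symm⟩

/-- The chords of a realizable diagram can be ordered so that, after moving the base point to the
chord `i`, all later chords `k` are traversed at times `X k < Y k` that separate the endpoints of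
exactly the chords intersecting `k`. -/
lemma Realizable.exists_window (hG : G.Realizable) : ∃ x : Fin n → ℝ, Function.Injective x ∧
    ∀ i, ∃ (γ γ' : ℝ → ℂ) (X Y : Fin n → ℝ), HasChordTimes γ γ' (X i) X Y ∧
      ∀ k, x i ≤ x k → X k = x k ∧ X k < Y k ∧
        ∀ l, G.Crosses k l ↔ ¬ (X l ∈ Ioo (X k) (Y k) ↔ Y l ∈ Ioo (X k) (Y k)) := by
  obtain ⟨γ, γ', x, y, h, hlt, hcr⟩ := hG.exists_chordTimes
  refine ⟨x, h.fst_injective, fun i => ⟨γ, γ',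
    fun k => if x k < x i then x k + 1 else x k, fun k => if y k < x i then y k + 1 else y k,
    ?_, fun k hik => ?_⟩⟩
  · have := h.shift (w := x i) (by simpa using h.fst_mem i)
    simpa only [lt_irrefl, if_false] using this
  · have hk := hlt k
    have hy := (h.snd_mem k).2
    have hx : ¬ x k < x i := not_lt.2 hik
    have hy' : ¬ y k < x i := by linarith
    simp only [if_neg hx, if_neg hy']
    refine ⟨trivial, hk, fun l => ?_⟩
    -- A time that gets shifted was below x i ≤ x k and lands at or above 1 > y k, so it is outside
    -- the interval both before and after.
    have hshift : ∀ s, 0 ≤ s →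
        ((if s < x i then s + 1 else s) ∈ Ioo (x k) (y k) ↔ s ∈ Ioo (x k) (y k)) := by
      intro s hs
      split_ifs with h'
      · exact ⟨fun h'' => by linarith [h''.2], fun h'' => by linarith [h''.1]⟩
      · rfl
    rw [hshift _ (h.fst_mem l).1, hshift _ (h.snd_mem l).1, hcr k l]
    have h1 := hlt l
    by_cases hkl : k = l
    · subst hkl; simp
    have h2 : x k ≠ x l := fun h' => hkl (h.fst_injective h')
    have h3 : y k ≠ y l := fun h' => hkl (h.snd_injective h')
    have h4 := h.fst_ne_snd k l
    have h5 := h.fst_ne_snd l k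
    simp only [mem_Ioo]
    grind

lemma not_crosses_self (hG : G.Realizable) (i : Fin n) : ¬ G.Crosses i i := by
  obtain ⟨x, -, hx⟩ := hG.exists_window
  obtain ⟨γ, γ', X, Y, -, h⟩ := hx i
  rw [(h i le_rfl).2.2 i]
  simp

lemma matrix_apply_eq (hG : G.Realizable) (i j : Fin n) :
    G.matrix i j = if G.Crosses i j then 1 else 0 := by
  rw [matrix, Matrix.of_apply]
  by_cases hij : i = j
  · subst hij; simp [not_crosses_self hG i]
  · simp [hij]

lemma dotProduct_matrix (hG : G.Realizable) (i j : Fin n) :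
    dotProduct (G.matrix i) (G.matrix j) =
      ((Finset.univ.filter fun t => G.Crosses i t ∧ G.Crosses j t).card : ZMod 2) := by
  rw [dotProduct, Finset.card_filter, Nat.cast_sum]
  refine Finset.sum_congr rfl fun t _ => ?_
  rw [matrix_apply_eq hG, matrix_apply_eq hG]
  by_cases h1 : G.Crosses i t <;> by_cases h2 : G.Crosses j t <;> simp [h1, h2]

lemma dotProduct_matrix_self (hG : G.Realizable) (i : Fin n) :
    dotProduct (G.matrix i) (G.matrix i) = 0 := by
  rw [dotProduct_matrix hG, ZMod.natCast_eq_zero_iff_even]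
  obtain ⟨x, -, hx⟩ := hG.exists_window
  obtain ⟨γ, γ', X, Y, h, hw⟩ := hx i
  obtain ⟨-, hlt, hcr⟩ := hw i le_rfl
  refine h.even_card_of_complementary_loops hlt _ fun k => ?_
  rw [Finset.mem_filter, and_self, hcr k]
  have h1 := h.fst_mem k
  have h2 := h.snd_mem k
  by_cases hki : k = i
  · subst hki; simp
  have h3 : X k ≠ X i := fun h' => hki (h.fst_injective h')
  have h4 : Y k ≠ Y i := fun h' => hki (h.snd_injective h')
  have h5 := h.fst_ne_snd k i
  have h6 := h.fst_ne_snd i k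
  simp only [mem_Ioo, mem_Ico, Finset.mem_univ, true_and] at h1 h2 ⊢
  grind

lemma dotProduct_matrix_of_not_crosses_of_lt (hG : G.Realizable) {x : Fin n → ℝ} {i j : Fin n}
    {γ γ' : ℝ → ℂ} {X Y : Fin n → ℝ} (h : HasChordTimes γ γ' (X i) X Y)
    (hw : ∀ k, x i ≤ x k → X k = x k ∧ X k < Y k ∧
        ∀ l, G.Crosses k l ↔ ¬ (X l ∈ Ioo (X k) (Y k) ↔ Y l ∈ Ioo (X k) (Y k)))
    (hij : x i < x j) (hcij : ¬ G.Crosses i j) :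
    dotProduct (G.matrix i) (G.matrix j) = 0 := by
  rw [dotProduct_matrix hG, ZMod.natCast_eq_zero_iff_even]
  obtain ⟨hXi, hi, hci⟩ := hw i le_rfl
  obtain ⟨hXj, hj, hcj⟩ := hw j hij.le
  rw [← hXi, ← hXj] at hij
  have hji : j ≠ i := by rintro rfl; exact lt_irrefl _ hij
  have hYY : Y i ≠ Y j := fun h' => hji (h.snd_injective h').symm
  have hXY := h.fst_ne_snd j i
  have hYj := (h.snd_mem j).2
  have hYi := (h.snd_mem i).2
  have hγi := h.apply_fst_eq i
  have hγj := h.apply_fst_eq j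
  have hγw : γ (X i + 1) = γ (X i) := h.periodic _
  have hcases : Y j < Y i ∨ Y i < X j := by
    have := (hci j).not.1 hcij
    simp only [mem_Ioo] at this
    grind
  have hne : ∀ k l, k ≠ l → X k ≠ X l ∧ Y k ≠ Y l := fun k l hkl =>
    ⟨fun h' => hkl (h.fst_injective h'), fun h' => hkl (h.snd_injective h')⟩
  -- For nested intervals the loop of j is paired with the complementary loop of i, which keeps the
  -- parameter intervals disjoint.
  rcases hcases with hlt | hlt
  · refine h.even_card_of_disjoint_loops (a := X j) (b := Y j) (c := Y i) (d := X i + 1) hij.le hj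
      hlt hYi le_rfl hγj (hγi.symm.trans hγw.symm) ?_ _ fun k => ?_
    · intro s hs t ht hst
      have hsj : γ s ≠ γ (X i) := fun h' => by
        rcases h.eq_or_of_apply_eq i ⟨hij.le.trans hs.1, by linarith [hs.2]⟩ h' with h1 | h1 | h1
        · linarith [hs.1]
        · linarith [hs.2]
        · linarith [hs.2, h1.2]
      have htj : γ t ≠ γ (X j) := fun h' => by
        rcases h.eq_or_of_apply_eq j ⟨by linarith [ht.1], ht.2⟩ h' with h1 | h1 | h1
        · linarith [ht.1]
        · linarith [ht.1]
        · exact hji h1.1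
      refine ⟨⟨lt_of_le_of_ne hs.1 ?_, lt_of_le_of_ne hs.2 ?_⟩,
        lt_of_le_of_ne ht.1 ?_, lt_of_le_of_ne ht.2 ?_⟩ <;> rintro rfl
      · exact htj hst.symm
      · exact htj (hst.symm.trans hγj.symm)
      · exact hsj (hst.trans hγi.symm)
      · exact hsj (hst.trans hγw)
    · rw [Finset.mem_filter, hci k, hcj k]
      have h1 := h.fst_mem k
      have h2 := h.snd_mem k
      have h3 := hne k i
      have h4 := hne k j
      have h5 := h.fst_ne_snd k i
      have h6 := h.fst_ne_snd i k
      have h7 := h.fst_ne_snd k j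
      have h8 := h.fst_ne_snd j k
      simp only [mem_Ioo, mem_Ico, Finset.mem_univ, true_and] at h1 h2 ⊢
      grind
  · refine h.even_card_of_disjoint_loops (a := X i) (b := Y i) (c := X j) (d := Y j) le_rfl hi
      hlt hj hYj.le hγi hγj ?_ _ fun k => ?_
    · intro s hs t ht hst
      have hsj : γ s ≠ γ (X j) := fun h' => by
        rcases h.eq_or_of_apply_eq j ⟨hs.1, by linarith [hs.2]⟩ h' with h1 | h1 | h1
        · linarith [hs.2]
        · linarith [hs.2]
        · exact hji h1.1
      have htj : γ t ≠ γ (X i) := fun h' => by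
        rcases h.eq_or_of_apply_eq i ⟨by linarith [ht.1], by linarith [ht.2]⟩ h' with h1 | h1 | h1
        · linarith [ht.1]
        · linarith [ht.1]
        · linarith [ht.2, h1.2]
      refine ⟨⟨lt_of_le_of_ne hs.1 ?_, lt_of_le_of_ne hs.2 ?_⟩,
        lt_of_le_of_ne ht.1 ?_, lt_of_le_of_ne ht.2 ?_⟩ <;> rintro rfl
      · exact htj hst.symm
      · exact htj (hst.symm.trans hγi.symm)
      · exact hsj hst
      · exact hsj (hst.trans hγj.symm)
    · rw [Finset.mem_filter, hci k, hcj k]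
      have h1 := h.fst_mem k
      have h2 := h.snd_mem k
      have h3 := hne k i
      have h4 := hne k j
      have h5 := h.fst_ne_snd k i
      have h6 := h.fst_ne_snd i k
      have h7 := h.fst_ne_snd k j
      have h8 := h.fst_ne_snd j k
      simp only [mem_Ioo, mem_Ico, Finset.mem_univ, true_and] at h1 h2 ⊢
      grind

lemma dotProduct_matrix_of_not_crosses (hG : G.Realizable) {i j : Fin n}
    (hcij : ¬ G.Crosses i j) : dotProduct (G.matrix i) (G.matrix j) = 0 := by
  by_cases hij : i = j
  · subst hij; exact dotProduct_matrix_self hG i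
  obtain ⟨x, hinj, hx⟩ := hG.exists_window
  rcases lt_or_gt_of_ne (hinj.ne hij) with h | h
  · obtain ⟨γ, γ', X, Y, h1, h2⟩ := hx i
    exact dotProduct_matrix_of_not_crosses_of_lt hG h1 h2 h hcij
  · obtain ⟨γ, γ', X, Y, h1, h2⟩ := hx j
    rw [dotProduct_comm]
    exact dotProduct_matrix_of_not_crosses_of_lt hG h1 h2 h fun h' => hcij h'.symm

/-- The product of `mᵢ + mⱼ` and `mᵢ + mₖ` counts the chords that intersect exactly one of `i, j`
and exactly one of `i, k`. -/
lemma dotProduct_matrix_add (hG : G.Realizable) (i j k : Fin n) :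
    dotProduct (G.matrix i + G.matrix j) (G.matrix i + G.matrix k) =
      ((Finset.univ.filter fun t => ¬ (G.Crosses i t ↔ G.Crosses j t) ∧
        ¬ (G.Crosses i t ↔ G.Crosses k t)).card : ZMod 2) := by
  rw [dotProduct, Finset.card_filter, Nat.cast_sum]
  refine Finset.sum_congr rfl fun t _ => ?_
  rw [Pi.add_apply, Pi.add_apply, matrix_apply_eq hG, matrix_apply_eq hG, matrix_apply_eq hG]
  by_cases h1 : G.Crosses i t <;> by_cases h2 : G.Crosses j t <;> by_cases h3 : G.Crosses k t <;>
    simp [h1, h2, h3] <;> decide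

/-- Pairwise intersection forces the cyclic order i, j, k, i, j, k of the six ends, so opposite arcs
join the same crossings. -/
lemma sum_dotProduct_matrix_of_lt (hG : G.Realizable) {x : Fin n → ℝ} {i j k : Fin n}
    {γ γ' : ℝ → ℂ} {X Y : Fin n → ℝ} (h : HasChordTimes γ γ' (X i) X Y)
    (hw : ∀ k, x i ≤ x k → X k = x k ∧ X k < Y k ∧
        ∀ l, G.Crosses k l ↔ ¬ (X l ∈ Ioo (X k) (Y k) ↔ Y l ∈ Ioo (X k) (Y k)))
    (hij : x i < x j) (hjk : x j < x k) (hcij : G.Crosses i j) (hcik : G.Crosses i k)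
    (hcjk : G.Crosses j k) :
    dotProduct (G.matrix i) (G.matrix j) + dotProduct (G.matrix i) (G.matrix k) +
      dotProduct (G.matrix j) (G.matrix k) = 1 := by
  obtain ⟨hXi, hi, hci⟩ := hw i le_rfl
  obtain ⟨hXj, hj, hcj⟩ := hw j hij.le
  obtain ⟨hXk, hk, hck⟩ := hw k (hij.trans hjk).le
  rw [← hXi, ← hXj] at hij
  rw [← hXj, ← hXk] at hjk
  have hji : j ≠ i := by rintro rfl; exact lt_irrefl _ hij
  have hkj : k ≠ j := by rintro rfl; exact lt_irrefl _ hjk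
  have hki : k ≠ i := by rintro rfl; exact lt_irrefl _ (hij.trans hjk)
  have hne : ∀ k l, k ≠ l → X k ≠ X l ∧ Y k ≠ Y l := fun k l hkl =>
    ⟨fun h' => hkl (h.fst_injective h'), fun h' => hkl (h.snd_injective h')⟩
  have hYij : Y i < Y j := by
    have h1 := (hci j).1 hcij
    have h2 := (hne j i hji).2
    simp only [mem_Ioo] at h1
    grind
  have hXki : X k < Y i := by
    have h1 := (hci k).1 hcik
    simp only [mem_Ioo] at h1
    grind
  have hYjk : Y j < Y k := by
    have h1 := (hcj k).1 hcjk
    have h2 := (hne k j hkj).2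
    simp only [mem_Ioo] at h1
    grind
  have hYk := (h.snd_mem k).2
  set A := Ioo (X i) (X j) ∪ Ioo (Y i) (Y j) with hA
  set B := Ioo (X k) (Y i) ∪ Ioo (Y k) (X i + 1) with hB
  set C : Finset (Fin n) := by
    classical exact Finset.univ.filter fun l => X l ∈ A ∧ Y l ∈ B ∨ Y l ∈ A ∧ X l ∈ B with hC
  have hCmem : ∀ l, l ∈ C ↔ X l ∈ A ∧ Y l ∈ B ∨ Y l ∈ A ∧ X l ∈ B := fun l => by
    simp [hC]
  have heven : Even C.card := h.even_card_of_bigons hij hjk hXki hYij hYjk C hCmem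
  have hiC : i ∉ C := by
    rw [hCmem, hA, hB]
    simp only [mem_union, mem_Ioo]
    grind
  -- Modulo 2, the indicator of A is the sum of those of the intervals of i and j, and that of B is
  -- 1 plus the sum for i and k. The 1 cancels over the two ends of a chord.
  have hpt : ∀ s ∈ Ico (X i) (X i + 1), s ≠ X i → s ≠ Y i → s ≠ X j → s ≠ Y j → s ≠ X k →
      s ≠ Y k → (s ∈ A ↔ ¬ (s ∈ Ioo (X i) (Y i) ↔ s ∈ Ioo (X j) (Y j))) ∧
        (s ∈ B ↔ (s ∈ Ioo (X i) (Y i) ↔ s ∈ Ioo (X k) (Y k))) ∧ ¬ (s ∈ A ∧ s ∈ B) := by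
    intro s hs h1 h2 h3 h4 h5 h6
    rw [hA, hB]
    simp only [mem_union, mem_Ioo, mem_Ico] at hs ⊢
    refine ⟨?_, ?_, ?_⟩ <;> grind
  -- The chord i meets j and k but not itself, so it is counted on the left without lying in C. It
  -- is the source of the 1.
  have hfilter : (Finset.univ.filter fun t => ¬ (G.Crosses i t ↔ G.Crosses j t) ∧
      ¬ (G.Crosses i t ↔ G.Crosses k t)) = insert i C := by
    ext t
    rw [Finset.mem_filter, Finset.mem_insert, hCmem]
    simp only [Finset.mem_univ, true_and]
    by_cases hti : t = i
    · subst hti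
      simp [not_crosses_self hG t, hcij.symm, hcik.symm]
    by_cases htj : t = j
    · subst htj
      have h1 : X t ∉ A := by rw [hA]; simp only [mem_union, mem_Ioo]; grind
      have h2 : Y t ∉ A := by rw [hA]; simp only [mem_union, mem_Ioo]; grind
      simp [hcij, hcjk.symm, hti, h1, h2]
    by_cases htk : t = k
    · subst htk
      have h1 : X t ∉ B := by rw [hB]; simp only [mem_union, mem_Ioo]; grind
      have h2 : Y t ∉ B := by rw [hB]; simp only [mem_union, mem_Ioo]; grind
      simp [hcik, hcjk, hti, h1, h2]
    obtain ⟨p1, p2, p3⟩ := hpt (X t) (h.fst_mem t) (hne t i hti).1 (h.fst_ne_snd t i)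
      (hne t j htj).1 (h.fst_ne_snd t j) (hne t k htk).1 (h.fst_ne_snd t k)
    obtain ⟨q1, q2, q3⟩ := hpt (Y t) (h.snd_mem t) (h.fst_ne_snd i t).symm (hne t i hti).2
      (h.fst_ne_snd j t).symm (hne t j htj).2 (h.fst_ne_snd k t).symm (hne t k htk).2
    rw [hci t, hcj t, hck t]
    simp only [hti, false_or]
    revert p1 p2 p3 q1 q2 q3
    generalize (X t ∈ A) = a₁, (X t ∈ B) = b₁, (Y t ∈ A) = a₂, (Y t ∈ B) = b₂,
      (X t ∈ Ioo (X i) (Y i)) = i₁, (Y t ∈ Ioo (X i) (Y i)) = i₂, (X t ∈ Ioo (X j) (Y j)) = j₁,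
      (Y t ∈ Ioo (X j) (Y j)) = j₂, (X t ∈ Ioo (X k) (Y k)) = k₁, (Y t ∈ Ioo (X k) (Y k)) = k₂
    clear * -
    grind
  have hsum := dotProduct_matrix_add hG i j k
  rw [hfilter, Finset.card_insert_of_notMem hiC, Nat.cast_add,
    (ZMod.natCast_eq_zero_iff_even).2 heven] at hsum
  simp only [add_dotProduct, dotProduct_add, dotProduct_matrix_self hG,
    dotProduct_comm (G.matrix j) (G.matrix i)] at hsum
  rw [← sub_eq_zero] at hsum ⊢
  rw [← hsum]
  push_cast
  ring

end GaussDiagram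

theorem theorem4p2 (n : ℕ) (G : GaussDiagram n) (hG : G.Realizable) :
    (∀ i : Fin n, dotProduct (G.matrix i) (G.matrix i) = 0) ∧
    (∀ i j : Fin n, ¬ G.Crosses i j → dotProduct (G.matrix i) (G.matrix j) = 0) ∧
    (∀ i j k : Fin n, G.Crosses i j → G.Crosses i k → G.Crosses j k →
      dotProduct (G.matrix i) (G.matrix j) + dotProduct (G.matrix i) (G.matrix k) +
        dotProduct (G.matrix j) (G.matrix k) = 1) := by
  refine ⟨GaussDiagram.dotProduct_matrix_self hG,
    fun i j => GaussDiagram.dotProduct_matrix_of_not_crosses hG, fun i j k hij hik hjk => ?_⟩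
  obtain ⟨x, hinj, hx⟩ := hG.exists_window
  have hne : ∀ {p q}, G.Crosses p q → x p ≠ x q := fun {p q} hpq h => by
    rw [hinj h] at hpq; exact GaussDiagram.not_crosses_self hG _ hpq
  have key : ∀ p q r, x p < x q → x q < x r → G.Crosses p q → G.Crosses p r → G.Crosses q r →
      dotProduct (G.matrix p) (G.matrix q) + dotProduct (G.matrix p) (G.matrix r) +
        dotProduct (G.matrix q) (G.matrix r) = 1 := by
    intro p q r hpq hqr
    obtain ⟨γ, γ', X, Y, h1, h2⟩ := hx p
    exact GaussDiagram.sum_dotProduct_matrix_of_lt hG h1 h2 hpq hqr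
  have cij := dotProduct_comm (G.matrix i) (G.matrix j)
  have cik := dotProduct_comm (G.matrix i) (G.matrix k)
  have cjk := dotProduct_comm (G.matrix j) (G.matrix k)
  -- The claim is symmetric, so the triple is sorted by x. Six sign patterns are orderings; the
  -- other two are cyclic and impossible.
  rcases lt_or_gt_of_ne (hne hij) with h1 | h1 <;> rcases lt_or_gt_of_ne (hne hik) with h2 | h2 <;>
    rcases lt_or_gt_of_ne (hne hjk) with h3 | h3
  · exact key i j k h1 h3 hij hik hjk
  · rw [← key i k j h2 h3 hik hij hjk.symm, cjk]; ring
  · exact absurd (h1.trans h3) (not_lt.2 h2.le)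
  · rw [← key k i j h2 h1 hik.symm hjk.symm hij, cik, cjk]; ring
  · rw [← key j i k h1 h2 hij.symm hjk hik, cij]; ring
  · exact absurd (h1.trans h2) (not_lt.2 h3.le)
  · rw [← key j k i h3 h2 hjk hij.symm hik.symm, cij, cik]; ring
  · rw [← key k j i h3 h1 hjk.symm hik.symm hij.symm, cij, cik, cjk]; ring
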